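/- Let $a,b>0$ and $\gamma,\widetilde\gamma,\theta_2\in\mathbb R$. Let $\Gamma_0$ be the infinite double-sided comb graph with inner vertices $x_j$, $j\in\mathbb Z$, an edge $e_j$ of length $a$ joining $x_{j-1}$ to $x_j$, and two edges $e_j^+$, $e_j^-$ of length $b/2$ joining $x_j$ to boundary vertices $x_j^+$, $x_j^-$; the coordinates on $e_j$, $e_j^-$, $e_j^+$ increase from $x_{j-1}$ to $x_j$, from $x_j^-$ to $x_j$, and from $x_j$ to $x_j^+$, respectively. Let $H_{\gamma,\widetilde\gamma}^{\theta_2}$ be the operator in $L^2(\Gamma_0)$ acting as $-\mathrm d^2/\mathrm dx^2$ on the edges, whose domain consists of the $\psi\in L^2(\Gamma_0)$ which are $H^2$ on each edge, satisfy $\psi''\in L^2(\Gamma_0)$, and obey the following conditions, where $\psi_j,\psi_j^\pm$ are the restrictions of $\psi$ to $e_j,e_j^\pm$: for every $j$, $\psi$ is continuous at $x_j$ and $$-\psi_j'(x_j)+\psi_{j+1}'(x_j)-(\psi_j^-)'(x_j)+(\psi_j^+)'(x_j)=\gamma_j\,\psi(x_j),\qquad \gamma_0=\widetilde\gamma,\quad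 \gamma_j=\gamma\ (j\ne0),$$ and $$\psi_j^+(x_j^+)=\mathrm e^{i\theta_2}\psi_j^-(x_j^-),\qquad (\psi_j^+)'(x_j^+)=\mathrm e^{i\theta_2}(\psi_j^-)'(x_j^-).$$ Put $H_\gamma^{\theta_2}=H_{\gamma,\gamma}^{\theta_2}$, $\Xi=\{k>0:\ \sin ka=0\text{ or }\sin kb=0\}$ and, for $\tau\in[-1,1]$ and $k\in(0,\infty)\setminus\Xi$, $$f_\gamma^\tau(k)=\frac{\gamma\sin ka}{2k}+\frac{\sin k(a+b)}{\sin kb}-\tau\,\frac{\sin ka}{\sin kb}.$$ The discrete spectrum $\sigma_{\rm disc}$ is the set of isolated points of the spectrum that are eigenvalues of finite multiplicity. **Theorem.** Let $E\in(0,\infty)\setminus\sigma(H_\gamma^{\theta_2})$, $k=\sqrt E$ and $\tau=\cos\theta_2$. If $k\notin\Xi$, then $|f_\gamma^\tau(k)|>1$, and $E\in\sigma_{\rm disc}(H_{\gamma,\widetilde\gamma}^{\theta_2})$ if and only if $$f_{\widetilde\gamma}^\tau(k)=\begin{cases} f_\gamma^\tau(k)+\sqrt{f_\gamma^\tau(k)^2-1},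 & \text{if } f_\gamma^\tau(k)<-1,\\ f_\gamma^\tau(k)-\sqrt{f_\gamma^\tau(k)^2-1}, & \text{if } f_\gamma^\tau(k)>1.\end{cases}$$ If $k\in\Xi$, then $E\notin\sigma_{\rm disc}(H_{\gamma,\widetilde\gamma}^{\theta_2})$. -/

import Mathlib

open MeasureTheory Set

noncomputable section

/-! ### Spectral theory of unbounded operators -/

/-- The resolvent set of an unbounded operator `T`: those `z` for which `T - z` maps the domain of
`T` bijectively onto the whole space, with a bounded (everywhere defined) inverse `R`. -/
def opResolventSet {H : Type*} [NormedAddCommGroup H] [NormedSpace ℂ H] (T : H →ₗ.[ℂ] H) : Set ℂ :=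
  {z | ∃ R : H →L[ℂ] H,
    (∀ g : H, ∃ h : R g ∈ T.domain, T ⟨R g, h⟩ - z • R g = g) ∧
    (∀ u : T.domain, R (T u - z • (u : H)) = u)}

/-- The spectrum of an unbounded operator. -/
def opSpectrum {H : Type*} [NormedAddCommGroup H] [NormedSpace ℂ H] (T : H →ₗ.[ℂ] H) : Set ℂ :=
  (opResolventSet T)ᶜ

/-- The space `ker (T - z)` of solutions `u` in the domain of `T` of `T u = z u`. -/
def opEigenspace {H : Type*} [NormedAddCommGroup H] [NormedSpace ℂ H] (T : H →ₗ.[ℂ] H) (z : ℂ) :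
    Submodule ℂ T.domain :=
  LinearMap.ker (T.toFun - z • T.domain.subtype)

/-- The discrete spectrum: the eigenvalues of finite multiplicity which are isolated points
of the spectrum. -/
def opDiscreteSpectrum {H : Type*} [NormedAddCommGroup H] [NormedSpace ℂ H] (T : H →ₗ.[ℂ] H) :
    Set ℂ :=
  {z | opEigenspace T z ≠ ⊥ ∧ FiniteDimensional ℂ (opEigenspace T z) ∧
    ∃ ε > 0, ∀ w ∈ opSpectrum T, dist w z < ε → w = z}

/-! ### The comb graph and its `L²` space -/

/-- The edges of the double sided comb with inner vertices `x_j`, `j ∈ ℤ`. The edge `horiz j`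
joins `x_{j-1}` to `x_j`; the edges `up j` and `down j` are attached to `x_j`, and their other
endpoint is a boundary vertex `x_j⁺` respectively `x_j⁻`. -/
inductive CombEdge : Type
  | horiz (j : ℤ)
  | up (j : ℤ)
  | down (j : ℤ)

/-- The left (lower) endpoint of the coordinate interval of an edge: `horiz j` is `[0, a]`, with `0`
at `x_{j-1}` and `a` at `x_j`; `up j` is `[0, b/2]` and `down j` is `[-b/2, 0]`, with `0` at
`x_j`. -/
def CombEdge.lo (b : ℝ) : CombEdge → ℝ
  | .horiz _ => 0
  | .up _ => 0
  | .down _ => -(b / 2)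

/-- The right (upper) endpoint of the coordinate interval of an edge. -/
def CombEdge.hi (a b : ℝ) : CombEdge → ℝ
  | .horiz _ => a
  | .up _ => b / 2
  | .down _ => 0

/-- Lebesgue measure on the coordinate interval of an edge. -/
abbrev combMeasure (a b : ℝ) (e : CombEdge) : Measure ℝ :=
  volume.restrict (Icc (e.lo b) (e.hi a b))

/-- The Hilbert space `L²(Γ₀)`: the `ℓ²`-direct sum of the spaces `L²(e)` over the edges `e` of the
comb. -/
abbrev CombL2 (a b : ℝ) : Type :=
  lp (fun e : CombEdge => Lp ℂ 2 (combMeasure a b e)) 2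

/-! ### The fiber operators -/

/-- On the interval `[l, r]` the function `φ` is differentiable with derivative `φ'`, and `φ'` is
absolutely continuous with `-φ'' = v` almost everywhere. For `v ∈ L²` this says that `φ` belongs to
the Sobolev space `H²(l, r)`, and that `-φ'' = v`. -/
structure IsNegSecondDeriv (l r : ℝ) (φ φ' v : ℝ → ℂ) : Prop where
  hasDeriv : ∀ x ∈ Icc l r, HasDerivWithinAt φ (φ' x) (Icc l r) x
  deriv_eq : ∀ x ∈ Icc l r, φ' x = φ' l - ∫ t in l..x, v t

/-- The strength of the coupling at the vertex `x_j`: it is `γ'` at `x_0` and `γ` at the others. -/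
def coupling (γ γ' : ℝ) (j : ℤ) : ℝ := if j = 0 then γ' else γ

/-- The vertex conditions for a function on the comb with edge components `φ e` and derivatives
`φ' e`: at every inner vertex the `δ`-condition (continuity, and the sum of the outgoing derivatives
equals the coupling strength times the value), and the quasiperiodic conditions with
quasimomentum `θ` at the boundary vertices. -/
structure CombVertexConditions (a b γ γ' θ : ℝ) (φ φ' : CombEdge → ℝ → ℂ) : Prop where
  cont_right : ∀ j : ℤ, φ (.horiz (j + 1)) 0 = φ (.horiz j) a
  cont_up : ∀ j : ℤ, φ (.up j) 0 = φ (.horiz j) a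
  cont_down : ∀ j : ℤ, φ (.down j) 0 = φ (.horiz j) a
  delta : ∀ j : ℤ,
    -φ' (.horiz j) a + φ' (.horiz (j + 1)) 0 - φ' (.down j) 0 + φ' (.up j) 0 =
      (coupling γ γ' j : ℂ) * φ (.horiz j) a
  quasi : ∀ j : ℤ,
    φ (.up j) (b / 2) = Complex.exp (Complex.I * θ) * φ (.down j) (-(b / 2))
  quasi_deriv : ∀ j : ℤ,
    φ' (.up j) (b / 2) = Complex.exp (Complex.I * θ) * φ' (.down j) (-(b / 2))

/-- `(u, v)` is in the graph of the fiber operator: `u` has an edgewise `H²` representative `φ` which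
satisfies the vertex conditions, and `v = -φ''` on every edge. -/
def InCombGraph (a b γ γ' θ : ℝ) (u v : CombL2 a b) : Prop :=
  ∃ φ φ' : CombEdge → ℝ → ℂ,
    (∀ e, (u e : ℝ → ℂ) =ᵐ[combMeasure a b e] φ e) ∧
    (∀ e, IsNegSecondDeriv (e.lo b) (e.hi a b) (φ e) (φ' e) (v e)) ∧
    CombVertexConditions a b γ γ' θ φ φ'

theorem CombL2.intervalIntegrable {a b : ℝ} (v : CombL2 a b) (e : CombEdge) {x : ℝ}
    (hx : x ∈ Icc (e.lo b) (e.hi a b)) : IntervalIntegrable (v e : ℝ → ℂ) volume (e.lo b) x := by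
  rw [intervalIntegrable_iff_integrableOn_Icc_of_le hx.1]
  have h : Integrable (v e : ℝ → ℂ) (combMeasure a b e) :=
    (Lp.memLp (v e)).integrable (by norm_num)
  exact IntegrableOn.mono_set (t := Icc (e.lo b) (e.hi a b)) h (Icc_subset_Icc_right hx.2)

theorem CombL2.integral_congr {a b : ℝ} {e : CombEdge} {f g : ℝ → ℂ}
    (h : f =ᵐ[combMeasure a b e] g) {x : ℝ} (hx : x ∈ Icc (e.lo b) (e.hi a b)) :
    ∫ t in (e.lo b)..x, f t = ∫ t in (e.lo b)..x, g t := by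
  apply intervalIntegral.integral_congr_ae
  have h2 := (ae_restrict_iff' measurableSet_Icc).1 h
  filter_upwards [h2] with t ht htm
  rw [uIoc_of_le hx.1] at htm
  exact ht ⟨htm.1.le, htm.2.trans hx.2⟩

/-- The graph of the fiber operator, as a linear subspace. -/
def combGraph (a b γ γ' θ : ℝ) : Submodule ℂ (CombL2 a b × CombL2 a b) where
  carrier := {p | InCombGraph a b γ γ' θ p.1 p.2}
  zero_mem' := by
    refine ⟨fun _ _ => 0, fun _ _ => 0, fun e => ?_, fun e => ⟨fun x _ => ?_, fun x hx => ?_⟩, ?_⟩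
    · exact Lp.coeFn_zero ℂ 2 (combMeasure a b e)
    · exact hasDerivWithinAt_const _ _ _
    · have h := CombL2.integral_congr (Lp.coeFn_zero ℂ 2 (combMeasure a b e)) hx
      change _ = _ - ∫ t in (e.lo b)..x, ((0 : Lp ℂ 2 (combMeasure a b e)) : ℝ → ℂ) t
      rw [h]; simp
    · constructor <;> simp
  add_mem' := by
    rintro ⟨u, v⟩ ⟨w, z⟩ ⟨φ, φ', h1, h2, h3⟩ ⟨ψ, ψ', k1, k2, k3⟩
    refine ⟨fun e x => φ e x + ψ e x, fun e x => φ' e x + ψ' e x, fun e => ?_,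
      fun e => ⟨fun x hx => ?_, fun x hx => ?_⟩, ?_⟩
    · filter_upwards [Lp.coeFn_add (u e) (w e), h1 e, k1 e] with x p1 p2 p3
      change ((u e + w e : Lp ℂ 2 (combMeasure a b e)) : ℝ → ℂ) x = _
      rw [p1, Pi.add_apply, p2, p3]
    · exact ((h2 e).hasDeriv x hx).add ((k2 e).hasDeriv x hx)
    · have h := CombL2.integral_congr (Lp.coeFn_add (v e) (z e)) hx
      change _ = _ - ∫ t in (e.lo b)..x, ((v e + z e : Lp ℂ 2 (combMeasure a b e)) : ℝ → ℂ) t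
      rw [h]
      simp only [Pi.add_apply]
      rw [intervalIntegral.integral_add (CombL2.intervalIntegrable v e hx)
        (CombL2.intervalIntegrable z e hx), (h2 e).deriv_eq x hx, (k2 e).deriv_eq x hx]
      ring
    · constructor
      · intro j; simp only [h3.cont_right, k3.cont_right]
      · intro j; simp only [h3.cont_up, k3.cont_up]
      · intro j; simp only [h3.cont_down, k3.cont_down]
      · intro j; linear_combination h3.delta j + k3.delta j
      · intro j; linear_combination h3.quasi j + k3.quasi j
      · intro j; linear_combination h3.quasi_deriv j + k3.quasi_deriv j
  smul_mem' := by
    rintro c ⟨u, v⟩ ⟨φ, φ', h1, h2, h3⟩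
    refine ⟨fun e x => c * φ e x, fun e x => c * φ' e x, fun e => ?_,
      fun e => ⟨fun x hx => ?_, fun x hx => ?_⟩, ?_⟩
    · filter_upwards [Lp.coeFn_smul c (u e), h1 e] with x p1 p2
      change ((c • u e : Lp ℂ 2 (combMeasure a b e)) : ℝ → ℂ) x = _
      rw [p1, Pi.smul_apply, p2, smul_eq_mul]
    · exact ((h2 e).hasDeriv x hx).const_mul c
    · have h := CombL2.integral_congr (Lp.coeFn_smul c (v e)) hx
      change _ = _ - ∫ t in (e.lo b)..x, ((c • v e : Lp ℂ 2 (combMeasure a b e)) : ℝ → ℂ) t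
      rw [h]
      simp only [Pi.smul_apply, smul_eq_mul]
      rw [intervalIntegral.integral_const_mul, (h2 e).deriv_eq x hx]
      ring
    · constructor
      · intro j; simp only [h3.cont_right]
      · intro j; simp only [h3.cont_up]
      · intro j; simp only [h3.cont_down]
      · intro j; linear_combination c * h3.delta j
      · intro j; linear_combination c * h3.quasi j
      · intro j; linear_combination c * h3.quasi_deriv j

/-- The perturbed fiber operator with quasimomentum `θ` on `L²(Γ₀)`: it acts as `-d²/dx²` on the
edges, on the functions which satisfy the vertex conditions with coupling `γ'` at `x_0` and `γ` at
the other inner vertices. -/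
def combOperator (a b γ γ' θ : ℝ) : CombL2 a b →ₗ.[ℂ] CombL2 a b :=
  (combGraph a b γ γ' θ).toLinearPMap

theorem combGraph_functional {a b : ℝ} (ha : 0 < a) (hb : 0 < b) (γ γ' θ : ℝ)
    (p : CombL2 a b × CombL2 a b) (hp : p ∈ combGraph a b γ γ' θ) (h0 : p.1 = 0) : p.2 = 0 := by
  obtain ⟨φ, φ', h1, h2, -⟩ := hp
  ext e : 2
  have hlt : e.lo b < e.hi a b := by
    cases e <;> simp only [CombEdge.lo, CombEdge.hi] <;> linarith
  have hφ : EqOn (φ e) (fun _ => 0) (Icc (e.lo b) (e.hi a b)) := by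
    refine Measure.eqOn_Icc_of_ae_eq volume hlt.ne ?_
      (fun x hx => ((h2 e).hasDeriv x hx).continuousWithinAt) continuousOn_const
    have hz := Lp.coeFn_zero ℂ 2 (combMeasure a b e)
    have hu := h1 e
    rw [h0] at hu
    filter_upwards [hz, hu] with x q1 q2
    rw [← q2]; exact q1
  have hφ' : ∀ x ∈ Icc (e.lo b) (e.hi a b), φ' e x = 0 := fun x hx =>
    (uniqueDiffOn_Icc hlt x hx).eq_deriv _ ((h2 e).hasDeriv x hx)
      ((hasDerivWithinAt_const x _ (0 : ℂ)).congr hφ (hφ hx))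
  have hint : ∀ x ∈ Icc (e.lo b) (e.hi a b), ∫ t in (e.lo b)..x, (p.2 e : ℝ → ℂ) t = 0 := by
    intro x hx
    have h := (h2 e).deriv_eq x hx
    rw [hφ' x hx, hφ' _ (left_mem_Icc.2 hlt.le), zero_sub] at h
    exact neg_eq_zero.1 h.symm
  have hi := CombL2.intervalIntegrable p.2 e (right_mem_Icc.2 hlt.le)
  apply Lp.ext
  have hz : ((0 : Lp ℂ 2 (combMeasure a b e)) : ℝ → ℂ) =ᵐ[combMeasure a b e] 0 :=
    Lp.coeFn_zero ℂ 2 (combMeasure a b e)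
  refine Filter.EventuallyEq.trans ?_ hz.symm
  refine (ae_restrict_iff' measurableSet_Icc).2 ?_
  filter_upwards [hi.ae_hasDerivAt_integral] with x hx hm
  have hd := hx (by rwa [uIcc_of_le hlt.le]) (e.lo b) left_mem_uIcc
  exact (uniqueDiffOn_Icc hlt x hm).eq_deriv _ hd.hasDerivWithinAt
    ((hasDerivWithinAt_const x _ (0 : ℂ)).congr hint (hint x hm))

/-- The graph of the fiber operator is `combGraph`. -/
theorem combOperator_graph {a b : ℝ} (ha : 0 < a) (hb : 0 < b) (γ γ' θ : ℝ) :
    (combOperator a b γ γ' θ).graph = combGraph a b γ γ' θ :=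
  Submodule.toLinearPMap_graph_eq _ (combGraph_functional ha hb γ γ' θ)

/-! ### The spectral function -/

/-- The momenta `k > 0` with `sin (k a) = 0` or `sin (k b) = 0`. -/
def XiSet (a b : ℝ) : Set ℝ := {k | 0 < k ∧ (Real.sin (k * a) = 0 ∨ Real.sin (k * b) = 0)}

/-- The function `f_γ^τ(k)`, for `k ∈ (0, ∞) \ XiSet a b`. -/
def combF (a b γ τ k : ℝ) : ℝ :=
  γ * Real.sin (k * a) / (2 * k) + Real.sin (k * (a + b)) / Real.sin (k * b)
    - τ * (Real.sin (k * a) / Real.sin (k * b))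

end

noncomputable section

/-! ### Green's identity on an interval -/

/-! Changing the coupling at the single vertex `x_0` is a rank one perturbation: the two graphs
differ by a multiple of a fixed function (`bump`) with zero value and unit slope at `x_0`, the
multiple being `γ' - γ` times the value at `x_0` (`isRankOnePerturbation_combOperator`). For `E` in
the resolvent set of the unperturbed operator let `G` be the Green function at `x_0`: the `L²`
solution of `-G'' = E G` with a unit source in the `δ`-condition there. Every perturbed eigenvector
is a multiple of `G`, and one exists exactly when `(γ' - γ) G(x_0) = 1`. Such an eigenvalue is
simple, and it is isolated: near `E` Krein's formula supplies the resolvent unless its denominator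
vanishes, which would give another eigenvector, orthogonal to `G` by symmetry yet close to `G` by
continuity. Only symmetry of the perturbed operator enters, not self-adjointness.

It remains to compute `G(x_0)`. Off `XiSet`, eliminating the derivatives turns the vertex conditions
into `G(x_{j+1}) + G(x_{j-1}) = 2 f G(x_j)`, plus the source `sin (k a) / k` at `j = 0`
(`IsSourcedSolution.recurrence`). If `|f| ≤ 1`, decay forces `G` to vanish at all vertices,
contradicting the source; hence `|f| > 1` in a gap. Otherwise `G(x_{±1}) = μ G(x_0)` with `μ` the
small root of `μ² - 2 f μ + 1`, so `2 (μ - f) G(x_0) = sin (k a) / k`. Since `f` is affine in `γ`,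
the eigenvalue condition becomes `f_{γ'} = μ`.

On `XiSet` one has `G(x_0) = 0`, so no eigenvalue appears: if `sin (k a) = 0` the vertex values have
constant modulus and decay, and if `sin (k b) = 0` the loop forces the value to vanish, unless `E`
lies in the unperturbed spectrum (`mem_opSpectrum_of_loop`). -/

theorem absolutelyContinuousOnInterval_integral {v : ℝ → ℂ} {l r : ℝ}
    (hv : IntervalIntegrable v volume l r) :
    AbsolutelyContinuousOnInterval (fun x => ∫ t in l..x, v t) l r := by
  -- Real and imaginary parts are handled separately, as real integrals multiplied by the constants
  -- `1` and `I`.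
  have key : ∀ w : ℝ → ℝ, IntervalIntegrable w volume l r → ∀ c : ℂ,
      AbsolutelyContinuousOnInterval (fun x => (∫ t in l..x, w t) • c) l r := by
    intro w hw c
    have h1 := hw.absolutelyContinuousOnInterval_intervalIntegral (c := l) left_mem_uIcc
    have h2 : AbsolutelyContinuousOnInterval (fun _ : ℝ => c) l r :=
      contDiffOn_const.absolutelyContinuousOnInterval
    exact h1.fun_smul h2
  have hre : IntervalIntegrable (fun t => (v t).re) volume l r := ⟨hv.1.re, hv.2.re⟩
  have him : IntervalIntegrable (fun t => (v t).im) volume l r := ⟨hv.1.im, hv.2.im⟩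
  have h := (key _ hre 1).fun_add (key _ him Complex.I)
  have hsub : ∀ x ∈ uIcc l r, (∫ t in l..x, v t) =
      (∫ t in l..x, (v t).re) • (1 : ℂ) + (∫ t in l..x, (v t).im) • Complex.I := by
    intro x hx
    have hm : uIcc l x ⊆ uIcc l r := uIcc_subset_uIcc_left hx
    rw [Complex.real_smul, Complex.real_smul, ← intervalIntegral.integral_ofReal,
      ← intervalIntegral.integral_ofReal, ← intervalIntegral.integral_mul_const,
      ← intervalIntegral.integral_mul_const, ← intervalIntegral.integral_add]
    · simp only [mul_one, Complex.re_add_im]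
    · exact IntervalIntegrable.mul_const ⟨(hre.mono_set hm).1.ofReal, (hre.mono_set hm).2.ofReal⟩ 1
    · exact IntervalIntegrable.mul_const ⟨(him.mono_set hm).1.ofReal, (him.mono_set hm).2.ofReal⟩ _
  rw [absolutelyContinuousOnInterval_iff] at h ⊢
  intro ε hε
  obtain ⟨δ, hδ, hd⟩ := h ε hε
  refine ⟨δ, hδ, fun I hI hlt => ?_⟩
  refine lt_of_eq_of_lt (Finset.sum_congr rfl fun i hi => ?_) (hd I hI hlt)
  have hm := hI.1 i hi
  rw [hsub _ hm.1, hsub _ hm.2]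

theorem IsNegSecondDeriv.deriv_continuousOn {l r : ℝ} {φ φ' v : ℝ → ℂ}
    (h : IsNegSecondDeriv l r φ φ' v) (hlr : l ≤ r) (hv : IntervalIntegrable v volume l r) :
    ContinuousOn φ' (Icc l r) := by
  have h1 := (absolutelyContinuousOnInterval_integral hv).continuousOn
  rw [uIcc_of_le hlr] at h1
  exact (continuousOn_const.sub h1).congr fun x hx => h.deriv_eq x hx

theorem IsNegSecondDeriv.continuousOn {l r : ℝ} {φ φ' v : ℝ → ℂ}
    (h : IsNegSecondDeriv l r φ φ' v) : ContinuousOn φ (Icc l r) :=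
  fun x hx => (h.hasDeriv x hx).continuousWithinAt

theorem IsNegSecondDeriv.absolutelyContinuousOnInterval {l r : ℝ} {φ φ' v : ℝ → ℂ}
    (h : IsNegSecondDeriv l r φ φ' v) (hlr : l ≤ r) (hv : IntervalIntegrable v volume l r) :
    AbsolutelyContinuousOnInterval φ l r := by
  obtain ⟨C, hC⟩ := isCompact_Icc.exists_bound_of_continuousOn (h.deriv_continuousOn hlr hv)
  have hL : LipschitzOnWith (Real.toNNReal C) φ (uIcc l r) := by
    rw [uIcc_of_le hlr]
    refine (convex_Icc l r).lipschitzOnWith_of_nnnorm_hasDerivWithin_le h.hasDeriv fun x hx => ?_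
    rw [← NNReal.coe_le_coe, coe_nnnorm]
    exact (hC x hx).trans (Real.le_coe_toNNReal C)
  exact hL.absolutelyContinuousOnInterval

/-- `φ' ψ - φ ψ'` minus the primitive of `φ w - v ψ` is absolutely continuous with derivative zero
almost everywhere, hence constant. The detour is needed because `v` and `w` are merely integrable,
so `φ'` and `ψ'` are differentiable only almost everywhere. -/
theorem IsNegSecondDeriv.green {l r : ℝ} {φ φ' v ψ ψ' w : ℝ → ℂ}
    (hφ : IsNegSecondDeriv l r φ φ' v) (hψ : IsNegSecondDeriv l r ψ ψ' w) (hlr : l ≤ r)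
    (hv : IntervalIntegrable v volume l r) (hw : IntervalIntegrable w volume l r) :
    (∫ x in l..r, φ x * w x) - ∫ x in l..r, v x * ψ x =
      (φ' r * ψ r - φ r * ψ' r) - (φ' l * ψ l - φ l * ψ' l) := by
  have hφc : ContinuousOn φ (uIcc l r) := by rw [uIcc_of_le hlr]; exact hφ.continuousOn
  have hψc : ContinuousOn ψ (uIcc l r) := by rw [uIcc_of_le hlr]; exact hψ.continuousOn
  have i1 : IntervalIntegrable (fun x => φ x * w x) volume l r := hw.continuousOn_mul hφc
  have i2 : IntervalIntegrable (fun x => v x * ψ x) volume l r := hv.mul_continuousOn hψc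
  have aφ := hφ.absolutelyContinuousOnInterval hlr hv
  have aψ := hψ.absolutelyContinuousOnInterval hlr hw
  have ac : ∀ c : ℂ, AbsolutelyContinuousOnInterval (fun _ : ℝ => c) l r :=
    fun c => contDiffOn_const.absolutelyContinuousOnInterval
  have av := (ac (φ' l)).fun_sub (absolutelyContinuousOnInterval_integral hv)
  have aw := (ac (ψ' l)).fun_sub (absolutelyContinuousOnInterval_integral hw)
  have aF := ((av.fun_smul aψ).fun_sub (aφ.fun_smul aw)).fun_sub
    ((absolutelyContinuousOnInterval_integral i1).fun_sub
      (absolutelyContinuousOnInterval_integral i2))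
  have hae : ∀ᵐ x : ℝ, x ≠ l ∧ x ≠ r := by
    have : ∀ᵐ x : ℝ, x ∈ ({l, r} : Set ℝ)ᶜ :=
      compl_mem_ae_iff.2 ((Set.toFinite {l, r}).measure_zero volume)
    filter_upwards [this] with x hx
    simpa [not_or] using hx
  obtain ⟨C, hC⟩ := aF.const_of_ae_hasDerivAt_zero (by
    filter_upwards [hv.ae_hasDerivAt_integral, hw.ae_hasDerivAt_integral,
      i1.ae_hasDerivAt_integral, i2.ae_hasDerivAt_integral, hae] with x d1 d2 d3 d4 hne hx
    have hxI : x ∈ Icc l r := by rwa [uIcc_of_le hlr] at hx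
    have hnhds : Icc l r ∈ nhds x :=
      Icc_mem_nhds (lt_of_le_of_ne hxI.1 hne.1.symm) (lt_of_le_of_ne hxI.2 hne.2)
    have e1 := (d1 hx l left_mem_uIcc).const_sub (φ' l)
    have e2 := (d2 hx l left_mem_uIcc).const_sub (ψ' l)
    have e3 := d3 hx l left_mem_uIcc
    have e4 := d4 hx l left_mem_uIcc
    have p1 := (hφ.hasDeriv x hxI).hasDerivAt hnhds
    have p2 := (hψ.hasDeriv x hxI).hasDerivAt hnhds
    have := ((e1.mul p2).sub (p1.mul e2)).sub (e3.sub e4)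
    refine this.congr_deriv ?_
    rw [hφ.deriv_eq x hxI, hψ.deriv_eq x hxI]
    ring)
  have hl := hC l left_mem_uIcc
  have hr := hC r right_mem_uIcc
  simp only [smul_eq_mul, intervalIntegral.integral_same, sub_zero] at hl hr
  rw [← hφ.deriv_eq r (right_mem_Icc.2 hlr), ← hψ.deriv_eq r (right_mem_Icc.2 hlr)] at hr
  linear_combination hl - hr

theorem IsNegSecondDeriv.of_hasDerivAt {l r : ℝ} {φ φ' v : ℝ → ℂ}
    (h1 : ∀ x, HasDerivAt φ (φ' x) x) (h2 : ∀ x, HasDerivAt φ' (-v x) x) (hv : Continuous v) :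
    IsNegSecondDeriv l r φ φ' v where
  hasDeriv x _ := (h1 x).hasDerivWithinAt
  deriv_eq x _ := by
    have h := intervalIntegral.integral_eq_sub_of_hasDerivAt (a := l) (b := x) (f := φ')
      (fun t _ => h2 t) (hv.neg.intervalIntegrable _ _)
    rw [intervalIntegral.integral_neg] at h
    linear_combination -h

theorem IsNegSecondDeriv.conj {l r : ℝ} {φ φ' v : ℝ → ℂ} (h : IsNegSecondDeriv l r φ φ' v) :
    IsNegSecondDeriv l r (fun x => starRingEnd ℂ (φ x)) (fun x => starRingEnd ℂ (φ' x))
      (fun x => starRingEnd ℂ (v x)) where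
  hasDeriv x hx := by
    have := Complex.conjCLE.hasFDerivAt.comp_hasDerivWithinAt x (h.hasDeriv x hx)
    exact this
  deriv_eq x hx := by
    rw [h.deriv_eq x hx, map_sub, sub_right_inj]
    simp only [intervalIntegral, map_sub]
    rw [integral_conj, integral_conj]

theorem IsNegSecondDeriv.congr {l r : ℝ} {φ φ' v w : ℝ → ℂ} (h : IsNegSecondDeriv l r φ φ' v)
    (hvw : v =ᵐ[volume.restrict (Icc l r)] w) : IsNegSecondDeriv l r φ φ' w where
  hasDeriv := h.hasDeriv
  deriv_eq x hx := by
    rw [h.deriv_eq x hx]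
    congr 1
    apply intervalIntegral.integral_congr_ae
    filter_upwards [(ae_restrict_iff' measurableSet_Icc).1 hvw] with t ht htm
    rw [uIoc_of_le hx.1] at htm
    exact ht ⟨htm.1.le, htm.2.trans hx.2⟩

theorem IsNegSecondDeriv.add_const_mul {l r : ℝ} {φ φ' v ψ ψ' w : ℝ → ℂ}
    (hφ : IsNegSecondDeriv l r φ φ' v) (hψ : IsNegSecondDeriv l r ψ ψ' w) (hlr : l ≤ r)
    (hv : IntervalIntegrable v volume l r) (hw : IntervalIntegrable w volume l r) (s : ℂ) :
    IsNegSecondDeriv l r (fun x => φ x + s * ψ x) (fun x => φ' x + s * ψ' x)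
      (fun x => v x + s * w x) where
  hasDeriv x hx := (hφ.hasDeriv x hx).add ((hψ.hasDeriv x hx).const_mul s)
  deriv_eq x hx := by
    have hm : uIcc l x ⊆ uIcc l r := uIcc_subset_uIcc_left (by rwa [uIcc_of_le hlr])
    rw [intervalIntegral.integral_add (hv.mono_set hm) ((hw.mono_set hm).const_mul s),
      intervalIntegral.integral_const_mul, hφ.deriv_eq x hx, hψ.deriv_eq x hx]
    ring

/-! ### Solutions of the eigenvalue equation on an interval -/

theorem isNegSecondDeriv_sin (k l r c : ℝ) :
    IsNegSecondDeriv l r (fun x => (Real.sin (k * (x - c)) : ℂ))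
      (fun x => (k * Real.cos (k * (x - c)) : ℝ))
      (fun x => (k ^ 2 : ℝ) * (Real.sin (k * (x - c)) : ℂ)) := by
  have hlin : ∀ x : ℝ, HasDerivAt (fun x : ℝ => k * (x - c)) k x := fun x => by
    simpa using ((hasDerivAt_id x).sub_const c).const_mul k
  refine .of_hasDerivAt (fun x => ?_) (fun x => ?_) (by fun_prop)
  · have := ((hlin x).sin).ofReal_comp
    refine this.congr_deriv ?_
    rw [mul_comm]
  · have := (((hlin x).cos).const_mul k).ofReal_comp
    refine this.congr_deriv ?_
    push_cast; ring

/-- The Wronskian of a solution `φ` of `-φ'' = k² φ` and the solution `sin (k (x - c))` takes the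
same value at both ends of the interval. -/
theorem IsNegSecondDeriv.wronskian_sin {k l r : ℝ} {φ φ' : ℝ → ℂ}
    (h : IsNegSecondDeriv l r φ φ' (fun x => (k ^ 2 : ℝ) * φ x)) (hlr : l ≤ r) (c : ℝ) :
    k * Real.cos (k * (r - c)) * φ r - Real.sin (k * (r - c)) * φ' r =
      k * Real.cos (k * (l - c)) * φ l - Real.sin (k * (l - c)) * φ' l := by
  have hc : ContinuousOn (fun x => ((k ^ 2 : ℝ) : ℂ) * φ x) (uIcc l r) := by
    rw [uIcc_of_le hlr]
    exact continuousOn_const.mul h.continuousOn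
  have := (isNegSecondDeriv_sin k l r c).green h hlr
    (by apply Continuous.intervalIntegrable; fun_prop) hc.intervalIntegrable
  have e : (∫ x in l..r, (Real.sin (k * (x - c)) : ℂ) * (((k ^ 2 : ℝ) : ℂ) * φ x)) =
      ∫ x in l..r, ((k ^ 2 : ℝ) : ℂ) * (Real.sin (k * (x - c)) : ℂ) * φ x :=
    intervalIntegral.integral_congr fun x _ => by ring
  rw [e, sub_self] at this
  push_cast at this ⊢
  linear_combination -this

/-- The cubic `(p + q x) (1 - x / L)²`, which vanishes to second order at `L`. -/
def endpointCubic (p q L x : ℝ) : ℝ := (p + q * x) * (1 - x / L) ^ 2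

/-- The derivative of `endpointCubic`. -/
def endpointCubicDeriv (p q L x : ℝ) : ℝ :=
  q * (1 - x / L) ^ 2 - (p + q * x) * (2 / L) * (1 - x / L)

/-- Minus the second derivative of `endpointCubic`. -/
def endpointCubicNegDeriv2 (p q L x : ℝ) : ℝ :=
  4 * q / L * (1 - x / L) - (p + q * x) * (2 / L ^ 2)

theorem isNegSecondDeriv_endpointCubic (p q L l r : ℝ) :
    IsNegSecondDeriv l r (fun x => (endpointCubic p q L x : ℂ))
      (fun x => (endpointCubicDeriv p q L x : ℂ))
      (fun x => (endpointCubicNegDeriv2 p q L x : ℂ)) := by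
  have h1 : ∀ x : ℝ, HasDerivAt (fun x : ℝ => 1 - x / L) (-(1 / L)) x := fun x => by
    simpa using ((hasDerivAt_id x).div_const L).const_sub 1
  have h2 : ∀ x : ℝ, HasDerivAt (fun x : ℝ => p + q * x) q x := fun x => by
    simpa using ((hasDerivAt_id x).const_mul q).const_add p
  refine .of_hasDerivAt (fun x => ?_) (fun x => ?_) (by unfold endpointCubicNegDeriv2; fun_prop)
  · refine (((h2 x).mul ((h1 x).pow 2)).ofReal_comp).congr_deriv ?_
    simp only [endpointCubicDeriv, Pi.pow_apply]
    push_cast; ring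
  · refine (((((h1 x).pow 2).const_mul q).sub
      (((h2 x).mul_const (2 / L)).mul (h1 x))).ofReal_comp).congr_deriv ?_
    simp only [endpointCubicNegDeriv2]
    push_cast; ring

/-! ### Rank one perturbations of unbounded operators -/

section Abstract

variable {H : Type*} [NormedAddCommGroup H]

/-- `R` is the resolvent at `z` of the operator with graph `T`. -/
structure IsResolventAt [NormedSpace ℂ H] (T : Submodule ℂ (H × H)) (z : ℂ) (R : H →L[ℂ] H) :
    Prop where
  mem : ∀ g, (R g, g + z • R g) ∈ T
  left_inv : ∀ u v, (u, v) ∈ T → R (v - z • u) = u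

theorem mem_opResolventSet_iff [NormedSpace ℂ H] (A : H →ₗ.[ℂ] H) (z : ℂ) :
    z ∈ opResolventSet A ↔ ∃ R, IsResolventAt A.graph z R := by
  constructor
  · rintro ⟨R, h1, h2⟩
    refine ⟨R, fun g => ?_, fun u v huv => ?_⟩
    · obtain ⟨h, e⟩ := h1 g
      rw [LinearPMap.mem_graph_iff]
      exact ⟨⟨R g, h⟩, rfl, by simp [← sub_eq_iff_eq_add, e]⟩
    · rw [LinearPMap.mem_graph_iff] at huv
      obtain ⟨y, hy1, hy2⟩ := huv
      simp only at hy1 hy2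
      rw [← hy2, ← hy1]
      exact h2 y
  · rintro ⟨R, h⟩
    refine ⟨R, fun g => ?_, fun u => h.left_inv _ _ (A.mem_graph u)⟩
    obtain ⟨y, hy1, hy2⟩ := (LinearPMap.mem_graph_iff A).1 (h.mem g)
    simp only at hy1 hy2
    have hd : R g ∈ A.domain := hy1 ▸ y.2
    have hy : y = ⟨R g, hd⟩ := Subtype.ext hy1
    exact ⟨hd, by rw [← hy, hy2, add_sub_cancel_right]⟩

theorem opEigenspace_ne_bot_iff [NormedSpace ℂ H] (A : H →ₗ.[ℂ] H) (z : ℂ) :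
    opEigenspace A z ≠ ⊥ ↔ ∃ u ≠ 0, (u, z • u) ∈ A.graph := by
  rw [Submodule.ne_bot_iff]
  constructor
  · rintro ⟨x, hx, h0⟩
    refine ⟨x, fun h => h0 (Subtype.ext h), ?_⟩
    rw [LinearPMap.mem_graph_iff]
    refine ⟨x, rfl, ?_⟩
    simpa [opEigenspace, sub_eq_zero] using hx
  · rintro ⟨u, hu, hm⟩
    obtain ⟨y, hy1, hy2⟩ := (LinearPMap.mem_graph_iff A).1 hm
    simp only at hy1 hy2
    refine ⟨y, ?_, fun h => hu (by rw [← hy1, h]; rfl)⟩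
    have : A.toFun y - z • (y : H) = 0 := by
      rw [hy1, sub_eq_zero]; exact hy2
    simpa [opEigenspace] using this

theorem finiteDimensional_opEigenspace [NormedSpace ℂ H] (A : H →ₗ.[ℂ] H) (z : ℂ) (G : H)
    (h : ∀ u, (u, z • u) ∈ A.graph → ∃ s : ℂ, u = s • G) :
    FiniteDimensional ℂ (opEigenspace A z) := by
  have hr : ∀ x : opEigenspace A z, ((x : A.domain) : H) ∈ Submodule.span ℂ {G} := by
    intro x
    have hx : A.toFun x.1 - z • (x.1 : H) = 0 := by
      have := x.2
      simpa [opEigenspace] using this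
    obtain ⟨s, hs⟩ := h (x.1 : H) (by
      rw [LinearPMap.mem_graph_iff]
      exact ⟨x.1, rfl, sub_eq_zero.1 hx⟩)
    exact Submodule.mem_span_singleton.2 ⟨s, hs.symm⟩
  refine FiniteDimensional.of_injective
    ((A.domain.subtype ∘ₗ (opEigenspace A z).subtype).codRestrict (Submodule.span ℂ {G}) hr)
    fun x y hxy => ?_
  have h1 : ((x : A.domain) : H) = y := congrArg (fun t : Submodule.span ℂ {G} => (t : H)) hxy
  exact Subtype.ext (Subtype.ext h1)

/-- The resolvent at `z` in terms of the resolvent `R` at `z₀`, for `z` near `z₀`. -/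
def neumannResolvent [NormedSpace ℂ H] (R : H →L[ℂ] H) (z₀ z : ℂ) : H →L[ℂ] H :=
  R * Ring.inverse (1 - (z - z₀) • R)

theorem neumannResolvent_self [NormedSpace ℂ H] (R : H →L[ℂ] H) (z₀ : ℂ) :
    neumannResolvent R z₀ z₀ = R := by
  simp [neumannResolvent]

/-- On the graph, `T - z = (1 - (z - z₀) R) (T - z₀)`, so inverting the first factor suffices. -/
theorem IsResolventAt.neumann [NormedSpace ℂ H] {T : Submodule ℂ (H × H)} {z₀ z : ℂ}
    {R : H →L[ℂ] H} (h : IsResolventAt T z₀ R) (hu : IsUnit (1 - (z - z₀) • R)) :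
    IsResolventAt T z (neumannResolvent R z₀ z) where
  mem g := by
    have h1 := congrArg (fun S : H →L[ℂ] H => S g) (Ring.mul_inverse_cancel _ hu)
    simp only [mul_apply_eq_comp, sub_apply, one_apply_eq_self, smul_apply] at h1
    have h2 := h.mem (Ring.inverse (1 - (z - z₀) • R) g)
    have h3 : neumannResolvent R z₀ z g = R (Ring.inverse (1 - (z - z₀) • R) g) := rfl
    rw [h3]
    generalize Ring.inverse (1 - (z - z₀) • R) g = y at h1 h2 ⊢
    have h4 : g + z • R y = y + z₀ • R y := by
      rw [← h1]
      module
    rwa [h4]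
  left_inv u v huv := by
    have h1 := h.left_inv u v huv
    have h2 : v - z • u = (1 - (z - z₀) • R) (v - z₀ • u) := by
      simp only [sub_apply, one_apply_eq_self,
        smul_apply, h1]
      module
    rw [h2, neumannResolvent, mul_apply_eq_comp, ← mul_apply_eq_comp
      (Ring.inverse _), Ring.inverse_mul_cancel _ hu, one_apply_eq_self, h1]

theorem eventually_isUnit_one_sub_smul [NormedSpace ℂ H] [CompleteSpace H] (R : H →L[ℂ] H)
    (z₀ : ℂ) : ∀ᶠ z in nhds z₀, IsUnit (1 - (z - z₀) • R) := by
  have hc : ContinuousAt (fun z : ℂ => (1 - (z - z₀) • R : H →L[ℂ] H)) z₀ := by fun_prop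
  exact hc.eventually_mem (Units.isOpen.mem_nhds (by simp))

theorem continuousAt_neumannResolvent [NormedSpace ℂ H] [CompleteSpace H] (R : H →L[ℂ] H)
    (z₀ : ℂ) : ContinuousAt (neumannResolvent R z₀) z₀ := by
  have hc : ContinuousAt (fun z : ℂ => (1 - (z - z₀) • R : H →L[ℂ] H)) z₀ := by fun_prop
  have hi := NormedRing.inverse_continuousAt (1 : (H →L[ℂ] H)ˣ)
  refine continuousAt_const.mul (ContinuousAt.comp (g := Ring.inverse) ?_ hc)
  simpa using hi

/-- `T'` is a rank one perturbation of `T`: the functions in the domain of `T'` are those in the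
domain of `T`, up to a multiple of the fixed element `W` which is determined by the functional `ℓ`
on the graph. -/
structure IsRankOnePerturbation [NormedSpace ℂ H] (T T' : Submodule ℂ (H × H))
    (ℓ : H × H →L[ℂ] ℂ) (W V : H) (κ : ℂ) : Prop where
  mem_iff : ∀ u v, (u, v) ∈ T' ↔
    (u - (κ * ℓ (u, v)) • W, v - (κ * ℓ (u, v)) • V) ∈ T
  vanish : ℓ (W, V) = 0

/-- The solution `G` of `(T - z) G = 0` up to the singular part `W`. -/
def singularSolution [NormedSpace ℂ H] (R : H →L[ℂ] H) (W V : H) (z : ℂ) : H :=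
  W - R (V - z • W)

theorem IsResolventAt.singularSolution_mem [NormedSpace ℂ H] {T : Submodule ℂ (H × H)} {z : ℂ}
    {R : H →L[ℂ] H} (h : IsResolventAt T z R) (W V : H) :
    (singularSolution R W V z - W, z • singularSolution R W V z - V) ∈ T := by
  have := T.neg_mem (h.mem (V - z • W))
  convert this using 1
  simp only [singularSolution, Prod.neg_mk, Prod.mk.injEq]
  constructor <;> module

theorem IsResolventAt.apply_sub [NormedSpace ℂ H] {T : Submodule ℂ (H × H)} {z : ℂ}
    {R : H →L[ℂ] H} (h : IsResolventAt T z R) {W V u v : H} {s : ℂ}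
    (hm : (u - s • W, v - s • V) ∈ T) :
    R (v - z • u) = u - s • singularSolution R W V z := by
  have h1 := h.left_inv _ _ hm
  have h2 : v - z • u = (v - s • V - z • (u - s • W)) + s • (V - z • W) := by module
  rw [h2, map_add, h1, map_smul, singularSolution]
  module

/-- Krein's formula: the new resolvent is `R` plus a rank one operator with range spanned by `G`,
and the hypothesis says that its denominator `m` is nonzero. -/
theorem IsRankOnePerturbation.exists_resolvent [NormedSpace ℂ H] {T T' : Submodule ℂ (H × H)}
    {ℓ : H × H →L[ℂ] ℂ} {W V : H} {κ z : ℂ} (hT : IsRankOnePerturbation T T' ℓ W V κ)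
    {R : H →L[ℂ] H} (h : IsResolventAt T z R)
    (hm : κ * ℓ (singularSolution R W V z, z • singularSolution R W V z) ≠ 1) :
    ∃ R', IsResolventAt T' z R' := by
  set G := singularSolution R W V z with hG
  set m : ℂ := 1 - κ * ℓ (G, z • G) with hmdef
  have hm0 : m ≠ 0 := fun h0 => hm (sub_eq_zero.1 h0).symm
  let P : H →L[ℂ] H × H := R.prod (ContinuousLinearMap.id ℂ H + z • R)
  have hP : ∀ g, P g = (R g, g + z • R g) := fun g => rfl
  -- The coefficient `s` of `G` must satisfy `s = κ ℓ(R g, g + z R g) + s κ ℓ(G, z G)`; solving for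
  -- `s` gives `α g`.
  let α : H →L[ℂ] ℂ := (κ / m) • (ℓ ∘L P)
  have hα : ∀ g, α g = κ / m * ℓ (R g, g + z • R g) := fun g => rfl
  have hαm : ∀ g, κ * ℓ (R g, g + z • R g) = α g * m := fun g => by
    rw [hα]; field_simp
  refine ⟨R + α.smulRight G, fun g => ?_, fun u v huv => ?_⟩
  · have hR : (R + α.smulRight G) g = R g + α g • G := rfl
    have e1 : (R g + α g • G, g + z • (R g + α g • G)) =
        (R g, g + z • R g) + α g • (G, z • G) := by
      simp only [Prod.smul_mk, Prod.mk_add_mk, Prod.mk.injEq, true_and]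
      module
    have e2 : κ * ℓ (R g + α g • G, g + z • (R g + α g • G)) = α g := by
      rw [e1, map_add, map_smul, mul_add, hαm, smul_eq_mul, hmdef]
      ring
    rw [hR, hT.mem_iff, e2]
    have := T.add_mem (h.mem g) (T.smul_mem (α g) (h.singularSolution_mem W V))
    convert this using 1
    simp only [Prod.smul_mk, Prod.mk_add_mk, Prod.mk.injEq]
    constructor <;> module
  · have hm' := (hT.mem_iff u v).1 huv
    set s := κ * ℓ (u, v) with hs
    have hR := h.apply_sub hm'
    rw [← hG] at hR
    have e1 : (R (v - z • u), v - z • u + z • R (v - z • u)) = (u, v) - s • (G, z • G) := by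
      rw [hR]
      simp only [Prod.smul_mk, Prod.mk_sub_mk, Prod.mk.injEq, true_and]
      module
    have e2 : α (v - z • u) = s := by
      apply mul_right_cancel₀ hm0
      rw [← hαm, e1, map_sub, map_smul, mul_sub, ← hs, smul_eq_mul, hmdef]
      ring
    change R (v - z • u) + α (v - z • u) • G = u
    rw [e2, hR]
    module

theorem IsRankOnePerturbation.singularSolution_mem [NormedSpace ℂ H]
    {T T' : Submodule ℂ (H × H)} {ℓ : H × H →L[ℂ] ℂ} {W V : H} {κ z : ℂ}
    (hT : IsRankOnePerturbation T T' ℓ W V κ) {R : H →L[ℂ] H} (h : IsResolventAt T z R)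
    (hm : κ * ℓ (singularSolution R W V z, z • singularSolution R W V z) = 1) :
    (singularSolution R W V z, z • singularSolution R W V z) ∈ T' := by
  rw [hT.mem_iff, hm, one_smul, one_smul]
  exact h.singularSolution_mem W V

theorem IsRankOnePerturbation.eigenvector_eq [NormedSpace ℂ H]
    {T T' : Submodule ℂ (H × H)} {ℓ : H × H →L[ℂ] ℂ} {W V : H} {κ z : ℂ}
    (hT : IsRankOnePerturbation T T' ℓ W V κ) {R : H →L[ℂ] H} (h : IsResolventAt T z R) {u : H}
    (hu : (u, z • u) ∈ T') :
    u = (κ * ℓ (u, z • u)) • singularSolution R W V z := by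
  have := h.apply_sub ((hT.mem_iff u _).1 hu)
  rwa [sub_self, map_zero, eq_comm, sub_eq_zero] at this

/-- An eigenvector is `s G` with `s = κ ℓ(u, z u)`; substituting it into its own coefficient yields
`s = s κ ℓ(G, z G)` with `s ≠ 0`. -/
theorem IsRankOnePerturbation.opEigenspace_ne_bot_iff [NormedSpace ℂ H]
    {A A' : H →ₗ.[ℂ] H} {ℓ : H × H →L[ℂ] ℂ} {W V : H} {κ z : ℂ}
    (hT : IsRankOnePerturbation A.graph A'.graph ℓ W V κ) {R : H →L[ℂ] H}
    (h : IsResolventAt A.graph z R) :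
    opEigenspace A' z ≠ ⊥ ↔
      κ * ℓ (singularSolution R W V z, z • singularSolution R W V z) = 1 := by
  rw [_root_.opEigenspace_ne_bot_iff]
  set G := singularSolution R W V z with hG
  constructor
  · rintro ⟨u, hu0, hu⟩
    have hue := hT.eigenvector_eq h hu
    rw [← hG] at hue
    set s := κ * ℓ (u, z • u) with hs
    have hs0 : s ≠ 0 := fun h => hu0 (by rw [hue, h, zero_smul])
    have h1 : (u, z • u) = s • (G, z • G) := by
      rw [Prod.smul_mk, smul_comm s z G, ← hue]
    apply mul_left_cancel₀ hs0
    rw [h1, map_smul, smul_eq_mul] at hs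
    linear_combination -hs
  · intro hm
    refine ⟨G, fun h0 => ?_, hT.singularSolution_mem h hm⟩
    rw [h0, smul_zero] at hm
    have : ((0 : H), (0 : H)) = 0 := rfl
    rw [this, map_zero, mul_zero] at hm
    exact zero_ne_one hm

/-- A real eigenvalue of a symmetric rank one perturbation of `T`, in the resolvent set of `T`, is
a point of the discrete spectrum. -/
theorem IsRankOnePerturbation.mem_opDiscreteSpectrum [InnerProductSpace ℂ H] [CompleteSpace H]
    {A A' : H →ₗ.[ℂ] H} {ℓ : H × H →L[ℂ] ℂ} {W V : H} {κ : ℂ}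
    (hT : IsRankOnePerturbation A.graph A'.graph ℓ W V κ)
    (hsym : ∀ u v u₂ v₂, (u, v) ∈ A'.graph → (u₂, v₂) ∈ A'.graph →
      inner ℂ u v₂ = inner ℂ v u₂)
    {E : ℝ} (hE : (E : ℂ) ∉ opSpectrum A) (hev : opEigenspace A' (E : ℂ) ≠ ⊥) :
    (E : ℂ) ∈ opDiscreteSpectrum A' := by
  obtain ⟨R, hR⟩ := (mem_opResolventSet_iff A E).1 (not_not.1 hE)
  obtain ⟨u, hu0, hu⟩ := (_root_.opEigenspace_ne_bot_iff A' E).1 hev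
  set G : ℂ → H := fun z => singularSolution (neumannResolvent R E z) W V z with hGdef
  have hGE : G E = singularSolution R W V E := by rw [hGdef]; simp [neumannResolvent_self]
  have hm := (hT.opEigenspace_ne_bot_iff hR).1 hev
  have hGmem : (G E, (E : ℂ) • G E) ∈ A'.graph := by
    rw [hGE]
    exact hT.singularSolution_mem hR hm
  have hG0 : G E ≠ 0 := by
    intro h0
    apply hu0
    rw [hT.eigenvector_eq hR hu, ← hGE, h0, smul_zero]
  refine ⟨hev, finiteDimensional_opEigenspace A' E (singularSolution R W V E)
    fun w hw => ⟨_, hT.eigenvector_eq hR hw⟩, ?_⟩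
  have hGc : ContinuousAt G E := by
    have h1 := continuousAt_neumannResolvent R (E : ℂ)
    exact continuousAt_const.sub (h1.clm_apply (by fun_prop))
  have hin : ∀ᶠ z in nhds (E : ℂ), inner ℂ (G E) (G z) ≠ 0 := by
    have h1 : ContinuousAt (fun z => inner ℂ (G E) (G z)) (E : ℂ) :=
      continuousAt_const.inner hGc
    exact h1.eventually_ne (by simpa using hG0)
  obtain ⟨ε, hε, hball⟩ := Metric.eventually_nhds_iff.1
    (hin.and (eventually_isUnit_one_sub_smul R (E : ℂ)))
  refine ⟨ε, hε, fun z hz hd => ?_⟩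
  obtain ⟨h1, h2⟩ := hball hd
  have hRz := hR.neumann h2
  by_contra hne
  apply hz
  rw [mem_opResolventSet_iff]
  -- If the Krein denominator vanished, `G z` would satisfy the eigenvalue equation at `z`, and
  -- symmetry would give `(z - E) ⟪G E, G z⟫ = 0`, whereas the inner product is nonzero near `E`.
  refine hT.exists_resolvent hRz fun hm => h1 ?_
  have := hsym _ _ _ _ hGmem (hT.singularSolution_mem hRz hm)
  change inner ℂ (G E) (z • G z) = inner ℂ ((E : ℂ) • G E) (G z) at this
  rw [inner_smul_left, inner_smul_right, Complex.conj_ofReal] at this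
  have h3 : (z - E) * inner ℂ (G E) (G z) = 0 := by rw [sub_mul, this, sub_self]
  exact (mul_eq_zero.1 h3).resolve_left (sub_ne_zero.2 hne)

end Abstract

/-! ### Test functions in `L²` of an interval -/

theorem memLp_two_of_continuous (l r : ℝ) {f : ℝ → ℂ} (hf : Continuous f) :
    MemLp f 2 (volume.restrict (Icc l r)) := by
  obtain ⟨C, hC⟩ := isCompact_Icc.exists_bound_of_continuousOn (s := Icc l r) hf.continuousOn
  refine MemLp.of_bound hf.aestronglyMeasurable C ?_
  filter_upwards [ae_restrict_mem measurableSet_Icc] with x hx using hC x hx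

/-- The class in `L²(l, r)` of a continuous function. -/
def intervalL2 (l r : ℝ) (f : ℝ → ℂ) (hf : Continuous f) : Lp ℂ 2 (volume.restrict (Icc l r)) :=
  (memLp_two_of_continuous l r hf).toLp f

theorem coeFn_intervalL2 (l r : ℝ) (f : ℝ → ℂ) (hf : Continuous f) :
    (intervalL2 l r f hf : ℝ → ℂ) =ᵐ[volume.restrict (Icc l r)] f :=
  MemLp.coeFn_toLp _

theorem intervalIntegrable_of_Lp_two {l r : ℝ} (hlr : l ≤ r)
    (v : Lp ℂ 2 (volume.restrict (Icc l r))) : IntervalIntegrable (v : ℝ → ℂ) volume l r := by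
  rw [intervalIntegrable_iff_integrableOn_Icc_of_le hlr]
  exact (Lp.memLp v).integrable (by norm_num)

theorem inner_eq_intervalIntegral {l r : ℝ} (hlr : l ≤ r)
    (u v : Lp ℂ 2 (volume.restrict (Icc l r))) {f g : ℝ → ℂ}
    (hu : (u : ℝ → ℂ) =ᵐ[volume.restrict (Icc l r)] f)
    (hv : (v : ℝ → ℂ) =ᵐ[volume.restrict (Icc l r)] g) :
    inner ℂ u v = ∫ x in l..r, starRingEnd ℂ (f x) * g x := by
  rw [MeasureTheory.L2.inner_def, intervalIntegral.integral_of_le hlr,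
    ← integral_Icc_eq_integral_Ioc]
  apply integral_congr_ae
  filter_upwards [hu, hv] with x h1 h2
  rw [h1, h2, RCLike.inner_apply, mul_comm]

theorem inner_green {l r : ℝ} (hlr : l ≤ r) {u v u₂ v₂ : Lp ℂ 2 (volume.restrict (Icc l r))}
    {φ φ' ψ ψ' : ℝ → ℂ} (hu : (u : ℝ → ℂ) =ᵐ[volume.restrict (Icc l r)] φ)
    (hφ : IsNegSecondDeriv l r φ φ' v) (hu₂ : (u₂ : ℝ → ℂ) =ᵐ[volume.restrict (Icc l r)] ψ)
    (hψ : IsNegSecondDeriv l r ψ ψ' v₂) :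
    inner ℂ u v₂ - inner ℂ v u₂ =
      (starRingEnd ℂ (φ' r) * ψ r - starRingEnd ℂ (φ r) * ψ' r) -
        (starRingEnd ℂ (φ' l) * ψ l - starRingEnd ℂ (φ l) * ψ' l) := by
  have hv := intervalIntegrable_of_Lp_two hlr v
  have hv' : IntervalIntegrable (fun x => starRingEnd ℂ (v x)) volume l r := by
    rw [intervalIntegrable_iff] at hv ⊢
    exact (Complex.conjLIE.integrable_comp_iff).2 hv
  rw [inner_eq_intervalIntegral hlr u v₂ hu Filter.EventuallyEq.rfl,
    inner_eq_intervalIntegral hlr v u₂ Filter.EventuallyEq.rfl hu₂]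
  exact hφ.conj.green hψ hlr hv' (intervalIntegrable_of_Lp_two hlr v₂)

theorem continuous_endpointCubic (p q L : ℝ) :
    Continuous fun x => (endpointCubic p q L x : ℂ) := by
  unfold endpointCubic; fun_prop

theorem continuous_endpointCubicNegDeriv2 (p q L : ℝ) :
    Continuous fun x => (endpointCubicNegDeriv2 p q L x : ℂ) := by
  unfold endpointCubicNegDeriv2; fun_prop

/-- `endpointCubic` as an element of `L²(0, L)`. -/
def cubicL2 (p q L : ℝ) : Lp ℂ 2 (volume.restrict (Icc 0 L)) :=
  intervalL2 0 L _ (continuous_endpointCubic p q L)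

/-- `endpointCubicNegDeriv2` as an element of `L²(0, L)`. -/
def cubicNegDeriv2L2 (p q L : ℝ) : Lp ℂ 2 (volume.restrict (Icc 0 L)) :=
  intervalL2 0 L _ (continuous_endpointCubicNegDeriv2 p q L)

theorem isNegSecondDeriv_cubicNegDeriv2L2 (p q L : ℝ) :
    IsNegSecondDeriv 0 L (fun x => (endpointCubic p q L x : ℂ))
      (fun x => (endpointCubicDeriv p q L x : ℂ)) (cubicNegDeriv2L2 p q L) :=
  (isNegSecondDeriv_endpointCubic p q L 0 L).congr (coeFn_intervalL2 _ _ _ _).symm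

/-- Green's identity against the cubic: its double zero at `L` kills that endpoint, and at `0` its
value `p` and slope `q - 2p/L` select a combination of `φ' 0` and `φ 0`. Traces thereby become
bounded functionals of `(u, v)`. -/
theorem inner_cubic_trace {L : ℝ} (hL : 0 < L) (p q : ℝ)
    {u v : Lp ℂ 2 (volume.restrict (Icc 0 L))}
    {φ φ' : ℝ → ℂ} (hu : (u : ℝ → ℂ) =ᵐ[volume.restrict (Icc 0 L)] φ)
    (hφ : IsNegSecondDeriv 0 L φ φ' v) :
    inner ℂ (cubicL2 p q L) v - inner ℂ (cubicNegDeriv2L2 p q L) u =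
      p * φ' 0 - (q - 2 * p / L) * φ 0 := by
  have h := inner_green hL.le (u := cubicL2 p q L) (v := cubicNegDeriv2L2 p q L)
    (coeFn_intervalL2 _ _ _ _) (isNegSecondDeriv_cubicNegDeriv2L2 p q L) hu hφ
  rw [h]
  simp only [Complex.conj_ofReal, endpointCubic, endpointCubicDeriv]
  rw [div_self hL.ne']
  push_cast
  ring

/-- The trace at `0` of an `H²` function is bounded by its graph norm. -/
theorem norm_cubic_trace_le {L : ℝ} (hL : 0 < L) (p q : ℝ)
    {u v : Lp ℂ 2 (volume.restrict (Icc 0 L))}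
    {φ φ' : ℝ → ℂ} (hu : (u : ℝ → ℂ) =ᵐ[volume.restrict (Icc 0 L)] φ)
    (hφ : IsNegSecondDeriv 0 L φ φ' v) :
    ‖p * φ' 0 - (q - 2 * p / L) * φ 0‖ ≤
      ‖cubicL2 p q L‖ * ‖v‖ + ‖cubicNegDeriv2L2 p q L‖ * ‖u‖ := by
  rw [← inner_cubic_trace hL p q hu hφ]
  exact (norm_sub_le _ _).trans (add_le_add (norm_inner_le_norm _ _) (norm_inner_le_norm _ _))

/-! ### Functions on the comb -/

instance : DecidableEq CombEdge := Classical.decEq _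

theorem CombEdge.lo_lt_hi {a b : ℝ} (ha : 0 < a) (hb : 0 < b) (e : CombEdge) :
    e.lo b < e.hi a b := by
  cases e <;> simp only [CombEdge.lo, CombEdge.hi] <;> linarith

theorem CombEdge.horiz_injective : Function.Injective CombEdge.horiz :=
  fun _ _ h => CombEdge.horiz.inj h

theorem CombL2.tendsto_norm_cofinite {a b : ℝ} (u : CombL2 a b) :
    Filter.Tendsto (fun e => ‖u e‖) Filter.cofinite (nhds 0) := by
  have h := ((lp.memℓp u).summable (by norm_num)).tendsto_cofinite_zero
  have h2 := (Real.continuous_sqrt.tendsto 0).comp h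
  rw [Real.sqrt_zero] at h2
  refine h2.congr fun e => ?_
  simp [Real.sqrt_sq]

/-- The data of a pair `(u, v)` with `u` edgewise in `H²` and `v = -u''`. -/
structure IsEdgewiseRep (a b : ℝ) (u v : CombL2 a b) (φ φ' : CombEdge → ℝ → ℂ) : Prop where
  ae_eq : ∀ e, (u e : ℝ → ℂ) =ᵐ[combMeasure a b e] φ e
  deriv2 : ∀ e, IsNegSecondDeriv (e.lo b) (e.hi a b) (φ e) (φ' e) (v e)

/-- The trace on each edge is controlled by the edge norms of `u` and `v`, which are square
summable. -/
theorem IsEdgewiseRep.tendsto_trace {a b : ℝ} (ha : 0 < a) {u v : CombL2 a b}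
    {φ φ' : CombEdge → ℝ → ℂ} (h : IsEdgewiseRep a b u v φ φ') (p q : ℝ) :
    Filter.Tendsto (fun j : ℤ => p * φ' (.horiz j) 0 - (q - 2 * p / a) * φ (.horiz j) 0)
      Filter.cofinite (nhds 0) := by
  have hu := u.tendsto_norm_cofinite.comp CombEdge.horiz_injective.tendsto_cofinite
  have hv := v.tendsto_norm_cofinite.comp CombEdge.horiz_injective.tendsto_cofinite
  have hlim := (hv.const_mul ‖cubicL2 p q a‖).add (hu.const_mul ‖cubicNegDeriv2L2 p q a‖)
  rw [mul_zero, mul_zero, add_zero] at hlim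
  exact squeeze_zero_norm (fun j => norm_cubic_trace_le (u := u (.horiz j)) (v := v (.horiz j))
    ha p q (h.ae_eq (.horiz j)) (h.deriv2 (.horiz j))) hlim

theorem IsEdgewiseRep.tendsto_value {a b : ℝ} (ha : 0 < a) {u v : CombL2 a b}
    {φ φ' : CombEdge → ℝ → ℂ} (h : IsEdgewiseRep a b u v φ φ') :
    Filter.Tendsto (fun j : ℤ => φ (.horiz j) 0) Filter.cofinite (nhds 0) := by
  simpa using (h.tendsto_trace ha 0 (-1))

theorem IsEdgewiseRep.tendsto_deriv {a b : ℝ} (ha : 0 < a) {u v : CombL2 a b}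
    {φ φ' : CombEdge → ℝ → ℂ} (h : IsEdgewiseRep a b u v φ φ') :
    Filter.Tendsto (fun j : ℤ => φ' (.horiz j) 0) Filter.cofinite (nhds 0) := by
  -- With `q = 2p/a` the cubic has slope zero at `0`, so only the derivative survives.
  simpa using (h.tendsto_trace ha 1 (2 / a))

/-- The extension by zero of a function on the edge `e`. -/
def edgeL2 (a b : ℝ) (e : CombEdge) (f : Lp ℂ 2 (combMeasure a b e)) : CombL2 a b :=
  lp.single 2 e f

theorem coeFn_edgeL2_self (a b : ℝ) (e : CombEdge) (f : Lp ℂ 2 (combMeasure a b e)) :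
    (edgeL2 a b e f e : ℝ → ℂ) = f :=
  congrArg (fun f : Lp ℂ 2 (combMeasure a b e) => (f : ℝ → ℂ))
    (lp.single_apply_self (E := fun e => Lp ℂ 2 (combMeasure a b e)) 2 e f)

theorem coeFn_edgeL2_of_ne (a b : ℝ) {e e' : CombEdge} (f : Lp ℂ 2 (combMeasure a b e))
    (h : e' ≠ e) : (edgeL2 a b e f e' : ℝ → ℂ) =ᵐ[combMeasure a b e'] fun _ => 0 :=
  (Filter.EventuallyEq.of_eq (congrArg (fun f : Lp ℂ 2 (combMeasure a b e') => (f : ℝ → ℂ))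
    (lp.single_apply_ne (E := fun e => Lp ℂ 2 (combMeasure a b e)) 2 e f h))).trans
    (Lp.coeFn_zero ℂ 2 (combMeasure a b e'))

theorem inner_edgeL2_left {a b : ℝ} (e : CombEdge) (f : Lp ℂ 2 (combMeasure a b e))
    (u : CombL2 a b) : inner ℂ (edgeL2 a b e f) u = inner ℂ f (u e) :=
  lp.inner_single_left e f u

/-! ### Symmetry of the comb operator -/

/-- The edges of the comb, grouped by their vertex. -/
def combEdgeEquiv : ℤ × Fin 3 ≃ CombEdge where
  toFun p := match p with
    | (j, 0) => .horiz j
    | (j, 1) => .up j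
    | (j, 2) => .down j
  invFun e := match e with
    | .horiz j => (j, 0)
    | .up j => (j, 1)
    | .down j => (j, 2)
  left_inv := by rintro ⟨j, i⟩; fin_cases i <;> rfl
  right_inv := by rintro (j | j | j) <;> rfl

theorem hasSum_combEdge {f : CombEdge → ℂ} {S : ℂ} (h : HasSum f S) :
    HasSum (fun j : ℤ => f (.horiz j) + f (.up j) + f (.down j)) S := by
  have h1 := (combEdgeEquiv.hasSum_iff).2 h
  refine h1.prod_fiberwise fun j => ?_
  have h2 := hasSum_fintype (fun i : Fin 3 => (f ∘ combEdgeEquiv) (j, i))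
  rw [Fin.sum_univ_three] at h2
  exact h2

theorem hasSum_telescope_eq_zero {B : ℤ → ℂ} {S : ℂ} (h : HasSum (fun j => B (j + 1) - B j) S)
    (hB : Filter.Tendsto B Filter.cofinite (nhds 0)) : S = 0 := by
  have h1 : Filter.Tendsto (fun n : ℕ => ∑ j ∈ Finset.Ico (-n : ℤ) n, (B (j + 1) - B j))
      Filter.atTop (nhds S) := h.comp Finset.tendsto_Ico_neg
  have h2 : ∀ n : ℕ, ∑ j ∈ Finset.Ico (-n : ℤ) n, (B (j + 1) - B j) = B n - B (-n) := by
    intro n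
    induction n with
    | zero => simp
    | succ n ih =>
      have e : Finset.Ico (-((n + 1 : ℕ) : ℤ)) ((n + 1 : ℕ) : ℤ) =
          insert (-(n + 1 : ℤ)) (insert (n : ℤ) (Finset.Ico (-n : ℤ) n)) := by
        ext j
        simp only [Finset.mem_Ico, Finset.mem_insert]
        push_cast
        omega
      rw [e, Finset.sum_insert (by simp), Finset.sum_insert (by simp), ih]
      push_cast
      rw [show -((n : ℤ) + 1) + 1 = -n by ring]
      ring
  have hn : Filter.Tendsto (fun n : ℕ => (n : ℤ)) Filter.atTop Filter.cofinite := by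
    rw [← Nat.cofinite_eq_atTop]
    exact Nat.cast_injective.tendsto_cofinite
  have hn' : Filter.Tendsto (fun n : ℕ => -(n : ℤ)) Filter.atTop Filter.cofinite := by
    rw [← Nat.cofinite_eq_atTop]
    exact (neg_injective.comp Nat.cast_injective).tendsto_cofinite
  have h3 := (hB.comp hn).sub (hB.comp hn')
  rw [sub_zero] at h3
  refine tendsto_nhds_unique h1 (h3.congr fun n => ?_)
  rw [h2]; rfl

/-- The boundary form `B` is conserved around each loop because the phase is unimodular, and through
each vertex because the coupling is real. The contributions of the edges grouped at `x_j` thus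
telescope along the spine, where `B` tends to zero. -/
theorem combGraph_symmetric {a b : ℝ} (ha : 0 < a) (hb : 0 < b) (γ γ' θ : ℝ)
    (u v u₂ v₂ : CombL2 a b) (h : (u, v) ∈ combGraph a b γ γ' θ)
    (h₂ : (u₂, v₂) ∈ combGraph a b γ γ' θ) : inner ℂ u v₂ = inner ℂ v u₂ := by
  obtain ⟨φ, φ', hφ1, hφ2, hφ⟩ := h
  obtain ⟨ψ, ψ', hψ1, hψ2, hψ⟩ := h₂
  have rφ : IsEdgewiseRep a b u v φ φ' := ⟨hφ1, hφ2⟩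
  have rψ : IsEdgewiseRep a b u₂ v₂ ψ ψ' := ⟨hψ1, hψ2⟩
  let B : CombEdge → ℝ → ℂ := fun e x =>
    starRingEnd ℂ (φ' e x) * ψ e x - starRingEnd ℂ (φ e x) * ψ' e x
  have hedge : ∀ e : CombEdge, inner ℂ (u e) (v₂ e) - inner ℂ (v e) (u₂ e) =
      B e (e.hi a b) - B e (e.lo b) := fun e =>
    inner_green (CombEdge.lo_lt_hi ha hb e).le (hφ1 e) (hφ2 e) (hψ1 e) (hψ2 e)
  have hsum := hasSum_combEdge ((lp.hasSum_inner (𝕜 := ℂ) u v₂).sub (lp.hasSum_inner (𝕜 := ℂ) v u₂))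
  have hexp : starRingEnd ℂ (Complex.exp (Complex.I * θ)) * Complex.exp (Complex.I * θ) = 1 := by
    rw [← Complex.exp_conj, ← Complex.exp_add]
    simp
  have hvert : ∀ j : ℤ, inner ℂ (u (.horiz j)) (v₂ (.horiz j)) -
        inner ℂ (v (.horiz j)) (u₂ (.horiz j)) +
      (inner ℂ (u (.up j)) (v₂ (.up j)) - inner ℂ (v (.up j)) (u₂ (.up j))) +
      (inner ℂ (u (.down j)) (v₂ (.down j)) - inner ℂ (v (.down j)) (u₂ (.down j))) =
      B (.horiz (j + 1)) 0 - B (.horiz j) 0 := by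
    intro j
    rw [hedge, hedge, hedge]
    have hq : B (.up j) (b / 2) = B (.down j) (-(b / 2)) := by
      simp only [B, hφ.quasi, hφ.quasi_deriv, hψ.quasi, hψ.quasi_deriv, map_mul]
      linear_combination (starRingEnd ℂ (φ' (.down j) (-(b / 2))) * ψ (.down j) (-(b / 2)) -
        starRingEnd ℂ (φ (.down j) (-(b / 2))) * ψ' (.down j) (-(b / 2))) * hexp
    have hd : B (.horiz j) a - B (.up j) 0 + B (.down j) 0 = B (.horiz (j + 1)) 0 := by
      have d1 := congrArg (starRingEnd ℂ) (hφ.delta j)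
      have d2 := hψ.delta j
      simp only [map_add, map_sub, map_neg, map_mul, Complex.conj_ofReal] at d1
      simp only [B, hφ.cont_right, hφ.cont_up, hφ.cont_down, hψ.cont_right, hψ.cont_up,
        hψ.cont_down]
      linear_combination (-ψ (.horiz j) a) * d1 + starRingEnd ℂ (φ (.horiz j) a) * d2
    change B (.horiz j) a - B (.horiz j) 0 + (B (.up j) (b / 2) - B (.up j) 0) +
      (B (.down j) 0 - B (.down j) (-(b / 2))) = _
    linear_combination hq + hd
  rw [funext hvert] at hsum
  have hB : Filter.Tendsto (fun j : ℤ => B (.horiz j) 0) Filter.cofinite (nhds 0) := by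
    have c : ∀ {f : ℤ → ℂ}, Filter.Tendsto f Filter.cofinite (nhds 0) →
        Filter.Tendsto (fun j => starRingEnd ℂ (f j)) Filter.cofinite (nhds 0) := fun hf => by
      have h0 := (Complex.continuous_conj.tendsto 0).comp hf
      rwa [map_zero] at h0
    simpa using ((c (rφ.tendsto_deriv ha)).mul (rψ.tendsto_value ha)).sub
      ((c (rφ.tendsto_value ha)).mul (rψ.tendsto_deriv ha))
  exact sub_eq_zero.1 (hasSum_telescope_eq_zero (B := fun j => B (.horiz j) 0) hsum hB)

/-! ### The rank one structure -/

/-- The function on the comb, supported on the edge `up 0`, which vanishes at `x_0` with slope `1`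
there, and vanishes to second order at the boundary vertex. -/
def bump (b : ℝ) (e : CombEdge) (x : ℝ) : ℂ :=
  if e = .up 0 then (endpointCubic 0 1 (b / 2) x : ℂ) else 0

/-- The derivative of `bump`. -/
def bumpDeriv (b : ℝ) (e : CombEdge) (x : ℝ) : ℂ :=
  if e = .up 0 then (endpointCubicDeriv 0 1 (b / 2) x : ℂ) else 0

theorem bump_up_zero (b : ℝ) :
    bump b (.up 0) = fun x => (endpointCubic 0 1 (b / 2) x : ℂ) :=
  funext fun _ => if_pos rfl

theorem bumpDeriv_up_zero (b : ℝ) :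
    bumpDeriv b (.up 0) = fun x => (endpointCubicDeriv 0 1 (b / 2) x : ℂ) :=
  funext fun _ => if_pos rfl

theorem bump_of_ne (b : ℝ) {e : CombEdge} (h : e ≠ .up 0) : bump b e = fun _ => 0 :=
  funext fun _ => if_neg h

theorem bumpDeriv_of_ne (b : ℝ) {e : CombEdge} (h : e ≠ .up 0) : bumpDeriv b e = fun _ => 0 :=
  funext fun _ => if_neg h

/-- The class of `bump` in `L²`. -/
def bumpL2 (a b : ℝ) : CombL2 a b :=
  edgeL2 a b (.up 0) (cubicL2 0 1 (b / 2))

/-- The class of minus the second derivative of `bump` in `L²`. -/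
def bumpNegDeriv2L2 (a b : ℝ) : CombL2 a b :=
  edgeL2 a b (.up 0) (cubicNegDeriv2L2 0 1 (b / 2))

theorem isEdgewiseRep_bump (a b : ℝ) :
    IsEdgewiseRep a b (bumpL2 a b) (bumpNegDeriv2L2 a b) (bump b) (bumpDeriv b) where
  ae_eq e := by
    by_cases h : e = .up 0
    · subst h
      rw [bump_up_zero]
      exact (Filter.EventuallyEq.of_eq (coeFn_edgeL2_self a b (.up 0) _)).trans
        (coeFn_intervalL2 0 (b / 2) _ (continuous_endpointCubic 0 1 (b / 2)))
    · rw [bump_of_ne b h]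
      exact coeFn_edgeL2_of_ne a b _ h
  deriv2 e := by
    by_cases h : e = .up 0
    · subst h
      rw [bump_up_zero, bumpDeriv_up_zero]
      exact (isNegSecondDeriv_cubicNegDeriv2L2 0 1 (b / 2)).congr
        (Filter.EventuallyEq.of_eq (coeFn_edgeL2_self a b (.up 0) _).symm)
    · rw [bump_of_ne b h, bumpDeriv_of_ne b h]
      exact IsNegSecondDeriv.congr (v := fun _ => 0) ⟨fun x _ => hasDerivWithinAt_const _ _ _,
        fun x _ => by simp⟩ (coeFn_edgeL2_of_ne a b _ h).symm

theorem IsEdgewiseRep.add_smul {a b : ℝ} (ha : 0 < a) (hb : 0 < b) {u v u₂ v₂ : CombL2 a b}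
    {φ φ' ψ ψ' : CombEdge → ℝ → ℂ} (h : IsEdgewiseRep a b u v φ φ')
    (h₂ : IsEdgewiseRep a b u₂ v₂ ψ ψ') (s : ℂ) :
    IsEdgewiseRep a b (u + s • u₂) (v + s • v₂) (fun e x => φ e x + s * ψ e x)
      (fun e x => φ' e x + s * ψ' e x) where
  ae_eq e := by
    filter_upwards [Lp.coeFn_add (u e) (s • u₂ e), Lp.coeFn_smul s (u₂ e), h.ae_eq e,
      h₂.ae_eq e] with x p1 p2 p3 p4
    change ((u e + s • u₂ e : Lp ℂ 2 (combMeasure a b e)) : ℝ → ℂ) x = _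
    rw [p1, Pi.add_apply, p2, Pi.smul_apply, p3, p4, smul_eq_mul]
  deriv2 e := by
    have hle := (CombEdge.lo_lt_hi ha hb e).le
    refine ((h.deriv2 e).add_const_mul (h₂.deriv2 e) hle
      (CombL2.intervalIntegrable v e (right_mem_Icc.2 hle))
      (CombL2.intervalIntegrable v₂ e (right_mem_Icc.2 hle)) s).congr ?_
    filter_upwards [Lp.coeFn_add (v e) (s • v₂ e), Lp.coeFn_smul s (v₂ e)] with x p1 p2
    change _ = ((v e + s • v₂ e : Lp ℂ 2 (combMeasure a b e)) : ℝ → ℂ) x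
    rw [p1, Pi.add_apply, p2, Pi.smul_apply, smul_eq_mul]

/-- The value at the vertex `x_0`, as a functional on pairs `(u, -u'')`. -/
def vertexValue (a b : ℝ) : CombL2 a b × CombL2 a b →L[ℂ] ℂ :=
  (innerSL ℂ (edgeL2 a b (.horiz 1) (cubicNegDeriv2L2 0 1 a))).comp
      (ContinuousLinearMap.fst ℂ _ _) -
    (innerSL ℂ (edgeL2 a b (.horiz 1) (cubicL2 0 1 a))).comp
      (ContinuousLinearMap.snd ℂ _ _)

theorem vertexValue_apply {a b : ℝ} (u v : CombL2 a b) :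
    vertexValue a b (u, v) =
      inner ℂ (cubicNegDeriv2L2 0 1 a : Lp ℂ 2 (combMeasure a b (.horiz 1))) (u (.horiz 1)) -
        inner ℂ (cubicL2 0 1 a : Lp ℂ 2 (combMeasure a b (.horiz 1))) (v (.horiz 1)) :=
  congrArg₂ (· - ·) (inner_edgeL2_left (.horiz 1) _ u) (inner_edgeL2_left (.horiz 1) _ v)

theorem IsEdgewiseRep.vertexValue_eq {a b : ℝ} (ha : 0 < a) {u v : CombL2 a b}
    {φ φ' : CombEdge → ℝ → ℂ} (h : IsEdgewiseRep a b u v φ φ') :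
    vertexValue a b (u, v) = φ (.horiz 1) 0 := by
  have := inner_cubic_trace (u := u (.horiz 1)) (v := v (.horiz 1)) ha 0 1
    (h.ae_eq (.horiz 1)) (h.deriv2 (.horiz 1))
  rw [vertexValue_apply]
  push_cast at this
  linear_combination -this

theorem vertexValue_bump {a b : ℝ} (ha : 0 < a) :
    vertexValue a b (bumpL2 a b, bumpNegDeriv2L2 a b) = 0 := by
  rw [(isEdgewiseRep_bump a b).vertexValue_eq ha]
  simp [bump]

/-- A multiple `s` of the bump adds `s` to the derivative sum at `x_0` and changes no other vertex
condition, so it can absorb the change of coupling. -/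
theorem combGraph_add_bump {a b : ℝ} (ha : 0 < a) (hb : 0 < b) {γ γ₁ γ₂ θ : ℝ}
    {u v : CombL2 a b} (h : (u, v) ∈ combGraph a b γ γ₁ θ) :
    (u + ((γ₂ - γ₁ : ℂ) * vertexValue a b (u, v)) • bumpL2 a b,
      v + ((γ₂ - γ₁ : ℂ) * vertexValue a b (u, v)) • bumpNegDeriv2L2 a b) ∈
        combGraph a b γ γ₂ θ := by
  obtain ⟨φ, φ', h1, h2, h3⟩ := h
  have r : IsEdgewiseRep a b u v φ φ' := ⟨h1, h2⟩
  have hval := r.vertexValue_eq ha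
  have hb' : b / 2 ≠ 0 := by positivity
  set s := (γ₂ - γ₁ : ℂ) * vertexValue a b (u, v) with hs
  have r' := r.add_smul ha hb (isEdgewiseRep_bump a b) s
  refine ⟨_, _, r'.ae_eq, r'.deriv2, ?_⟩
  have hc := h3.cont_right 0
  rw [zero_add] at hc
  constructor
  · intro j; simp [bump, h3.cont_right]
  · intro j; simp [bump, h3.cont_up, endpointCubic]
  · intro j; simp [bump, h3.cont_down]
  · intro j
    have hd := h3.delta j
    by_cases hj : j = 0
    · subst hj
      simp [bump, bumpDeriv, coupling, endpointCubicDeriv] at hd ⊢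
      rw [hs, hval, hc]
      linear_combination hd
    · simp [bump, bumpDeriv, coupling, hj] at hd ⊢
      linear_combination hd
  · intro j; simp [bump, h3.quasi, endpointCubic, hb.ne']
  · intro j; simp [bumpDeriv, h3.quasi_deriv, endpointCubicDeriv, hb.ne']

theorem isRankOnePerturbation_combOperator {a b : ℝ} (ha : 0 < a) (hb : 0 < b) (γ γ' θ : ℝ) :
    IsRankOnePerturbation (combOperator a b γ γ θ).graph (combOperator a b γ γ' θ).graph
      (vertexValue a b) (bumpL2 a b) (bumpNegDeriv2L2 a b) (γ' - γ : ℂ) where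
  vanish := vertexValue_bump ha
  mem_iff u v := by
    rw [combOperator_graph ha hb, combOperator_graph ha hb]
    constructor
    · intro h
      have := combGraph_add_bump ha hb (γ₂ := γ) h
      convert this using 1
      simp only [Prod.mk.injEq]
      constructor <;> module
    · intro h
      have := combGraph_add_bump ha hb (γ₂ := γ') h
      -- The bump vanishes at `x_0`, so the coefficient is the same before and after removing it.
      have e : vertexValue a b (u - ((γ' - γ : ℂ) * vertexValue a b (u, v)) • bumpL2 a b,
          v - ((γ' - γ : ℂ) * vertexValue a b (u, v)) • bumpNegDeriv2L2 a b) =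
          vertexValue a b (u, v) := by
        have e1 : ∀ s : ℂ, (u - s • bumpL2 a b, v - s • bumpNegDeriv2L2 a b) =
          (u, v) - s • (bumpL2 a b, bumpNegDeriv2L2 a b) := fun s => rfl
        rw [e1, map_sub, map_smul, vertexValue_bump ha, smul_zero, sub_zero]
      rw [e, sub_add_cancel, sub_add_cancel] at this
      exact this

/-! ### Decaying solutions of three term recurrences -/

/-- The defect `d (n + 1) - μ * d n` is reproduced by the other root `1 / μ`, so its norm cannot
decrease; tending to zero, it vanishes. -/
theorem eq_mul_of_recurrence_of_tendsto_zero {d : ℕ → ℂ} {f : ℝ} {μ : ℂ}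
    (hμ : μ ^ 2 - 2 * f * μ + 1 = 0) (hμ1 : ‖μ‖ ≤ 1)
    (hd : ∀ n, d (n + 2) + d n = 2 * f * d (n + 1))
    (h0 : Filter.Tendsto d Filter.atTop (nhds 0)) (n : ℕ) : d (n + 1) = μ * d n := by
  have hstep : ∀ n, μ * (d (n + 2) - μ * d (n + 1)) = d (n + 1) - μ * d n := fun n => by
    linear_combination μ * hd n - d (n + 1) * hμ
  have hmono : Monotone fun n => ‖d (n + 1) - μ * d n‖ := by
    refine monotone_nat_of_le_succ fun n => ?_
    rw [← hstep n, norm_mul]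
    exact mul_le_of_le_one_left (norm_nonneg _) hμ1
  have hlim : Filter.Tendsto (fun n => ‖d (n + 1) - μ * d n‖) Filter.atTop (nhds 0) := by
    simpa using (((Filter.tendsto_add_atTop_iff_nat 1).2 h0).sub (h0.const_mul μ)).norm
  exact sub_eq_zero.1 (norm_le_zero_iff.1 (hmono.ge_of_tendsto hlim n))

theorem eq_zero_of_norm_eq_of_tendsto_zero {d : ℕ → ℂ} (hd : ∀ n, ‖d (n + 1)‖ = ‖d n‖)
    (h0 : Filter.Tendsto d Filter.atTop (nhds 0)) (n : ℕ) : d n = 0 := by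
  have hmono : Monotone fun n => ‖d n‖ := monotone_nat_of_le_succ fun n => (hd n).ge
  have hlim : Filter.Tendsto (fun n => ‖d n‖) Filter.atTop (nhds 0) := by simpa using h0.norm
  exact norm_le_zero_iff.1 (hmono.ge_of_tendsto hlim n)

/-- For `|f| ≤ 1` the characteristic roots lie on the unit circle, so a decaying solution has
constant modulus. -/
theorem eq_zero_of_recurrence_of_abs_le_one {d : ℕ → ℂ} {f : ℝ} (hf : |f| ≤ 1)
    (hd : ∀ n, d (n + 2) + d n = 2 * f * d (n + 1))
    (h0 : Filter.Tendsto d Filter.atTop (nhds 0)) (n : ℕ) : d n = 0 := by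
  have hsq : f ^ 2 ≤ 1 := by rwa [sq_le_one_iff_abs_le_one]
  set g := √(1 - f ^ 2) with hg
  have hg2 : g ^ 2 = 1 - f ^ 2 := Real.sq_sqrt (by linarith)
  have hg2' : (g : ℂ) ^ 2 = 1 - (f : ℂ) ^ 2 := by exact_mod_cast hg2
  have hnorm : ‖(f + g * Complex.I : ℂ)‖ = 1 := by
    rw [Complex.norm_add_mul_I, hg2]
    simp
  have hroot : (f + g * Complex.I : ℂ) ^ 2 - 2 * f * (f + g * Complex.I) + 1 = 0 := by
    linear_combination (g : ℂ) ^ 2 * Complex.I_sq - hg2'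
  refine eq_zero_of_norm_eq_of_tendsto_zero (fun n => ?_) h0 n
  rw [eq_mul_of_recurrence_of_tendsto_zero hroot hnorm.le hd h0 n, norm_mul, hnorm, one_mul]

/-! ### Solutions of the eigenvalue equation on the comb with a source at one vertex -/

/-- A solution of `-φ'' = k² φ` on the comb, decaying along the spine, which satisfies the vertex
conditions except for a source of strength `s` at `x_0`. -/
structure IsSourcedSolution (a b γ θ k : ℝ) (s : ℂ) (φ φ' : CombEdge → ℝ → ℂ) : Prop where
  eqn : ∀ e, IsNegSecondDeriv (e.lo b) (e.hi a b) (φ e) (φ' e) (fun x => (k ^ 2 : ℝ) * φ e x)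
  decay : Filter.Tendsto (fun j : ℤ => φ (.horiz j) 0) Filter.cofinite (nhds 0)
  cont_right : ∀ j : ℤ, φ (.horiz (j + 1)) 0 = φ (.horiz j) a
  cont_up : ∀ j : ℤ, φ (.up j) 0 = φ (.horiz j) a
  cont_down : ∀ j : ℤ, φ (.down j) 0 = φ (.horiz j) a
  delta : ∀ j : ℤ,
    -φ' (.horiz j) a + φ' (.horiz (j + 1)) 0 - φ' (.down j) 0 + φ' (.up j) 0 =
      γ * φ (.horiz j) a + if j = 0 then s else 0
  quasi : ∀ j : ℤ,
    φ (.up j) (b / 2) = Complex.exp (Complex.I * θ) * φ (.down j) (-(b / 2))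
  quasi_deriv : ∀ j : ℤ,
    φ' (.up j) (b / 2) = Complex.exp (Complex.I * θ) * φ' (.down j) (-(b / 2))

theorem IsEdgewiseRep.eqn_of_smul {a b : ℝ} {u : CombL2 a b} {φ φ' : CombEdge → ℝ → ℂ} {k : ℝ}
    {z : ℂ} (hz : z = (k ^ 2 : ℝ)) (h : IsEdgewiseRep a b u (z • u) φ φ') (e : CombEdge) :
    IsNegSecondDeriv (e.lo b) (e.hi a b) (φ e) (φ' e) (fun x => (k ^ 2 : ℝ) * φ e x) := by
  refine (h.deriv2 e).congr ?_
  filter_upwards [Lp.coeFn_smul z (u e), h.ae_eq e] with x p1 p2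
  change ((z • u e : Lp ℂ 2 (combMeasure a b e)) : ℝ → ℂ) x = _
  rw [p1, Pi.smul_apply, p2, smul_eq_mul, hz]

theorem exists_isSourcedSolution {a b : ℝ} (ha : 0 < a) (hb : 0 < b) {γ θ k : ℝ} {s z : ℂ}
    (hz : z = (k ^ 2 : ℝ)) {u : CombL2 a b}
    (h : (u - s • bumpL2 a b, z • u - s • bumpNegDeriv2L2 a b) ∈ combGraph a b γ γ θ) :
    ∃ φ φ', IsSourcedSolution a b γ θ k s φ φ' ∧
      φ (.horiz 0) a = vertexValue a b (u, z • u) := by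
  obtain ⟨φ, φ', h1, h2, h3⟩ := h
  have r := IsEdgewiseRep.add_smul ha hb ⟨h1, h2⟩ (isEdgewiseRep_bump a b) s
  simp only [sub_add_cancel] at r
  have hb' : b / 2 ≠ 0 := by positivity
  have hc := h3.cont_right 0
  rw [zero_add] at hc
  refine ⟨_, _, ⟨r.eqn_of_smul hz, r.tendsto_value ha, ?_, ?_, ?_, ?_, ?_, ?_⟩, ?_⟩
  · intro j; simp [bump, h3.cont_right]
  · intro j; simp [bump, h3.cont_up, endpointCubic]
  · intro j; simp [bump, h3.cont_down]
  · intro j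
    have hd := h3.delta j
    by_cases hj : j = 0
    · subst hj
      simp [bump, bumpDeriv, coupling, endpointCubicDeriv] at hd ⊢
      linear_combination hd
    · simp [bump, bumpDeriv, coupling, hj] at hd ⊢
      linear_combination hd
  · intro j; simp [bump, h3.quasi, endpointCubic, hb.ne']
  · intro j; simp [bumpDeriv, h3.quasi_deriv, endpointCubicDeriv, hb.ne']
  · rw [r.vertexValue_eq ha]
    simp [bump, hc]

/-! ### Reduction of sourced solutions to their values at the inner vertices -/

namespace IsSourcedSolution

variable {a b γ θ k : ℝ} {s : ℂ} {φ φ' : CombEdge → ℝ → ℂ}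

theorem deriv_right (h : IsSourcedSolution a b γ θ k s φ φ') (ha : 0 < a) (j : ℤ) :
    Real.sin (k * a) * φ' (.horiz (j + 1)) a =
      k * Real.cos (k * a) * φ (.horiz (j + 1)) a - k * φ (.horiz j) a := by
  have := (h.eqn (.horiz (j + 1))).wronskian_sin (ha.le : (0 : ℝ) ≤ a) 0
  simp only [CombEdge.lo, CombEdge.hi, sub_zero, sub_self, mul_zero, Real.cos_zero,
    Real.sin_zero, h.cont_right] at this
  push_cast at this ⊢
  linear_combination -this

theorem deriv_left (h : IsSourcedSolution a b γ θ k s φ φ') (ha : 0 < a) (j : ℤ) :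
    Real.sin (k * a) * φ' (.horiz (j + 1)) 0 =
      k * φ (.horiz (j + 1)) a - k * Real.cos (k * a) * φ (.horiz j) a := by
  have := (h.eqn (.horiz (j + 1))).wronskian_sin (ha.le : (0 : ℝ) ≤ a) a
  simp only [CombEdge.lo, CombEdge.hi, sub_self, mul_zero, Real.cos_zero,
    Real.sin_zero, h.cont_right, zero_sub, mul_neg, Real.cos_neg, Real.sin_neg] at this
  push_cast at this ⊢
  linear_combination -this

/-- `up j` followed by `down j` is a loop of length `b` crossed with a phase; the Wronskian with a
sine vanishing at the loop coordinate `c` is carried around it. -/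
theorem loop (h : IsSourcedSolution a b γ θ k s φ φ') (hb : 0 < b) (c : ℝ) (j : ℤ) :
    k * Real.cos (k * c) * φ (.horiz j) a + Real.sin (k * c) * φ' (.up j) 0 =
      Complex.exp (Complex.I * θ) * (k * Real.cos (k * (b - c)) * φ (.horiz j) a -
        Real.sin (k * (b - c)) * φ' (.down j) 0) := by
  have h1 := (h.eqn (.up j)).wronskian_sin (half_pos hb).le c
  have h2 := (h.eqn (.down j)).wronskian_sin (neg_nonpos.2 (half_pos hb).le) (c - b)
  simp only [CombEdge.lo, CombEdge.hi, zero_sub, mul_neg, Real.cos_neg, Real.sin_neg, h.quasi,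
    h.quasi_deriv, h.cont_up, h.cont_down, neg_sub] at h1 h2
  rw [show -(b / 2) - (c - b) = b / 2 - c by ring] at h2
  push_cast at h1 h2 ⊢
  linear_combination -h1 - Complex.exp (Complex.I * θ) * h2

theorem recurrence (h : IsSourcedSolution a b γ θ k s φ φ') (ha : 0 < a) (hb : 0 < b)
    (hk : 0 < k) (hsa : Real.sin (k * a) ≠ 0) (hsb : Real.sin (k * b) ≠ 0) (j : ℤ) :
    φ (.horiz (j + 1)) a + φ (.horiz (j - 1)) a =
      2 * combF a b γ (Real.cos θ) k * φ (.horiz j) a +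
        (Real.sin (k * a) / k : ℝ) * if j = 0 then s else 0 := by
  have e1 := h.deriv_right ha (j - 1)
  rw [sub_add_cancel] at e1
  have e2 := h.deriv_left ha j
  -- Taking `c = 0` isolates the derivative on `down j`, and `c = b` the one on `up j`.
  have e3 := h.loop hb 0 j
  have e4 := h.loop hb b j
  have e5 := h.delta j
  simp only [mul_zero, Real.cos_zero, Real.sin_zero, sub_zero, sub_self] at e3 e4
  have hcos : Complex.exp (Complex.I * θ) + Complex.exp (-(Complex.I * θ)) =
      2 * (Real.cos θ : ℂ) := by
    rw [Complex.ofReal_cos, Complex.two_cos, mul_comm, neg_mul]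
  have hexp : Complex.exp (-(Complex.I * θ)) * Complex.exp (Complex.I * θ) = 1 := by
    rw [← Complex.exp_add]; simp
  have hk' : (k : ℂ) ≠ 0 := by exact_mod_cast hk.ne'
  have hsa' : (Real.sin (k * a) : ℂ) ≠ 0 := by exact_mod_cast hsa
  have hsb' : (Real.sin (k * b) : ℂ) ≠ 0 := by exact_mod_cast hsb
  rw [combF, mul_add k a b, Real.sin_add]
  apply mul_left_cancel₀ (mul_ne_zero hk' hsb')
  push_cast at e1 e2 e3 e4 e5 hcos hsa' hsb' ⊢
  generalize (if j = 0 then s else 0) = t at e5 ⊢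
  generalize Complex.exp (Complex.I * θ) = ε at hexp hcos e3 e4
  generalize Complex.exp (-(Complex.I * θ)) = δ at hexp hcos
  generalize Complex.sin (k * a) = sa at *
  generalize Complex.sin (k * b) = sb at *
  generalize Complex.cos (k * a) = ca at *
  generalize Complex.cos (k * b) = cb at *
  field_simp
  linear_combination sb * e1 - sb * e2 + sa * sb * e5 - sa * e4 + sa * δ * e3 +
    sa * (k * cb * φ (.horiz j) a - sb * φ' (.down j) 0) * hexp - sa * k * φ (.horiz j) a * hcos

theorem tendsto_nat (h : IsSourcedSolution a b γ θ k s φ φ') :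
    Filter.Tendsto (fun n : ℕ => φ (.horiz n) a) Filter.atTop (nhds 0) := by
  simp_rw [← h.cont_right]
  have hn : Function.Injective fun n : ℕ => (n : ℤ) + 1 := fun m n hmn => by
    simpa using hmn
  rw [← Nat.cofinite_eq_atTop]
  exact h.decay.comp hn.tendsto_cofinite

theorem tendsto_neg_nat (h : IsSourcedSolution a b γ θ k s φ φ') :
    Filter.Tendsto (fun n : ℕ => φ (.horiz (-n)) a) Filter.atTop (nhds 0) := by
  simp_rw [← h.cont_right]
  have hn : Function.Injective fun n : ℕ => -(n : ℤ) + 1 := fun m n hmn => by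
    simpa using hmn
  rw [← Nat.cofinite_eq_atTop]
  exact h.decay.comp hn.tendsto_cofinite

theorem recurrence_nat (h : IsSourcedSolution a b γ θ k s φ φ') (ha : 0 < a) (hb : 0 < b)
    (hk : 0 < k) (hsa : Real.sin (k * a) ≠ 0) (hsb : Real.sin (k * b) ≠ 0) (n : ℕ) :
    φ (.horiz ((n + 2 : ℕ) : ℤ)) a + φ (.horiz n) a =
      2 * combF a b γ (Real.cos θ) k * φ (.horiz ((n + 1 : ℕ) : ℤ)) a := by
  have := h.recurrence ha hb hk hsa hsb (n + 1)
  rw [if_neg (by omega), mul_zero, add_zero, add_sub_cancel_right, add_assoc] at this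
  exact_mod_cast this

theorem recurrence_neg_nat (h : IsSourcedSolution a b γ θ k s φ φ') (ha : 0 < a) (hb : 0 < b)
    (hk : 0 < k) (hsa : Real.sin (k * a) ≠ 0) (hsb : Real.sin (k * b) ≠ 0) (n : ℕ) :
    φ (.horiz (-((n + 2 : ℕ) : ℤ))) a + φ (.horiz (-n)) a =
      2 * combF a b γ (Real.cos θ) k * φ (.horiz (-((n + 1 : ℕ) : ℤ))) a := by
  have := h.recurrence ha hb hk hsa hsb (-((n + 1 : ℕ) : ℤ))
  rw [if_neg (by omega), mul_zero, add_zero] at this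
  rw [← this, add_comm]
  congr 4
  all_goals push_cast; ring

theorem source_eq_zero_of_abs_le_one (h : IsSourcedSolution a b γ θ k s φ φ') (ha : 0 < a)
    (hb : 0 < b) (hk : 0 < k) (hsa : Real.sin (k * a) ≠ 0) (hsb : Real.sin (k * b) ≠ 0)
    (hf : |combF a b γ (Real.cos θ) k| ≤ 1) : s = 0 := by
  have h1 := eq_zero_of_recurrence_of_abs_le_one hf (h.recurrence_nat ha hb hk hsa hsb)
    h.tendsto_nat
  have h2 := eq_zero_of_recurrence_of_abs_le_one hf (h.recurrence_neg_nat ha hb hk hsa hsb)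
    h.tendsto_neg_nat
  have h3 := h.recurrence ha hb hk hsa hsb 0
  have c0 := h1 0
  have c1 := h1 1
  have c2 := h2 1
  simp only [Nat.cast_zero, Nat.cast_one] at c0 c1 c2
  rw [zero_add, zero_sub, c0, c1, c2, if_pos rfl, mul_zero, zero_add, zero_add, eq_comm] at h3
  exact (mul_eq_zero.1 h3).resolve_left (by exact_mod_cast div_ne_zero hsa hk.ne')

theorem source_eq (h : IsSourcedSolution a b γ θ k s φ φ') (ha : 0 < a)
    (hb : 0 < b) (hk : 0 < k) (hsa : Real.sin (k * a) ≠ 0) (hsb : Real.sin (k * b) ≠ 0) {μ : ℝ}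
    (hμ : μ ^ 2 - 2 * combF a b γ (Real.cos θ) k * μ + 1 = 0) (hμ1 : |μ| ≤ 1) :
    2 * (μ - combF a b γ (Real.cos θ) k : ℝ) * φ (.horiz 0) a =
      (Real.sin (k * a) / k : ℝ) * s := by
  have hroot : (μ : ℂ) ^ 2 - 2 * (combF a b γ (Real.cos θ) k : ℝ) * μ + 1 = 0 := by
    exact_mod_cast hμ
  have hnorm : ‖(μ : ℂ)‖ ≤ 1 := by simpa using hμ1
  have h1 := eq_mul_of_recurrence_of_tendsto_zero hroot hnorm
    (h.recurrence_nat ha hb hk hsa hsb) h.tendsto_nat 0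
  have h2 := eq_mul_of_recurrence_of_tendsto_zero hroot hnorm
    (h.recurrence_neg_nat ha hb hk hsa hsb) h.tendsto_neg_nat 0
  have h3 := h.recurrence ha hb hk hsa hsb 0
  simp only [zero_add, Nat.cast_zero, Nat.cast_one, neg_zero] at h1 h2
  rw [zero_add, zero_sub, if_pos rfl, h1, h2] at h3
  push_cast at h3 ⊢
  linear_combination h3

theorem value_eq_zero_of_sin_eq_zero (h : IsSourcedSolution a b γ θ k s φ φ') (ha : 0 < a)
    (hk : 0 < k) (hsa : Real.sin (k * a) = 0) : φ (.horiz 0) a = 0 := by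
  have hcos : |Real.cos (k * a)| = 1 := by
    rcases Real.sin_eq_zero_iff_cos_eq.1 hsa with h | h <;> simp [h]
  refine eq_zero_of_norm_eq_of_tendsto_zero (fun n => ?_) h.tendsto_nat 0
  have := h.deriv_right ha n
  rw [hsa, Complex.ofReal_zero, zero_mul, eq_comm, mul_assoc, ← mul_sub, mul_eq_zero] at this
  have h2 := sub_eq_zero.1 (this.resolve_left (by exact_mod_cast hk.ne'))
  have h3 := congrArg norm h2
  rw [norm_mul, Complex.norm_real, Real.norm_eq_abs, hcos, one_mul] at h3
  exact_mod_cast h3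

theorem value_eq_zero_of_exp_ne (h : IsSourcedSolution a b γ θ k s φ φ')
    (hb : 0 < b) (hk : 0 < k) (hsb : Real.sin (k * b) = 0)
    (hexp : Complex.exp (Complex.I * θ) ≠ Real.cos (k * b)) : φ (.horiz 0) a = 0 := by
  have h1 := h.loop hb b 0
  simp only [hsb, mul_zero, Real.cos_zero, Real.sin_zero, sub_self, Complex.ofReal_zero, zero_mul,
    Complex.ofReal_one, sub_zero, add_zero, mul_one] at h1
  have h2 : (k * (Real.cos (k * b) - Complex.exp (Complex.I * θ))) * φ (.horiz 0) a = 0 := by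
    linear_combination h1
  refine (mul_eq_zero.1 h2).resolve_left (mul_ne_zero (by exact_mod_cast hk.ne') ?_)
  exact sub_ne_zero.2 hexp.symm

end IsSourcedSolution

/-- If `sin (k ·)` closes up on the loops, then `k²` is in the spectrum. -/
theorem mem_opSpectrum_of_loop {a b : ℝ} (ha : 0 < a) (hb : 0 < b) {γ γ' θ k : ℝ} {z : ℂ}
    (hz : z = (k ^ 2 : ℝ)) (hk : 0 < k) (hsb : Real.sin (k * b) = 0)
    (hexp : Complex.exp (Complex.I * θ) = Real.cos (k * b)) :
    z ∈ opSpectrum (combOperator a b γ γ' θ) := by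
  intro hres
  obtain ⟨R, hR⟩ := (mem_opResolventSet_iff _ _).1 hres
  have hb2 : 0 < b / 2 := half_pos hb
  have hsin : Continuous fun x : ℝ => (Real.sin (k * (x - 0)) : ℂ) := by fun_prop
  have hsin2 : Continuous fun x : ℝ => ((k ^ 2 : ℝ) * Real.sin (k * (x - 0)) : ℂ) := by fun_prop
  let p : Lp ℂ 2 (combMeasure a b (.up 0)) := intervalL2 0 (b / 2) _ hsin
  let p2 : Lp ℂ 2 (combMeasure a b (.up 0)) := intervalL2 0 (b / 2) _ hsin2
  have hp2 : p2 = ((k ^ 2 : ℝ) : ℂ) • p := by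
    apply Lp.ext
    refine (coeFn_intervalL2 0 (b / 2) _ hsin2).trans ?_
    filter_upwards [Lp.coeFn_smul ((k ^ 2 : ℝ) : ℂ) p, coeFn_intervalL2 0 (b / 2) _ hsin]
      with x h1 h2
    rw [h1, Pi.smul_apply, smul_eq_mul]
    exact congrArg _ h2.symm
  -- The source is the loop eigenfunction cut off to the upper half of the loop. Green's identity
  -- there gives `⟪p, p⟫` as boundary terms, which the homogeneous equation on the lower half makes
  -- cancel.
  have hmem := hR.mem (edgeL2 a b (.up 0) p)
  rw [combOperator_graph ha hb] at hmem
  set u := R (edgeL2 a b (.up 0) p) with hu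
  obtain ⟨φ, φ', h1, h2, h3⟩ := hmem
  have hup : inner ℂ p ((edgeL2 a b (.up 0) p + z • u) (.up 0)) - inner ℂ p2 (u (.up 0)) = _ :=
    inner_green hb2.le (u := p) (v := p2)
      (coeFn_intervalL2 0 (b / 2) _ hsin)
      ((isNegSecondDeriv_sin k 0 (b / 2) 0).congr (coeFn_intervalL2 0 (b / 2) _ hsin2).symm)
      (h1 (.up 0)) (h2 (.up 0))
  have hval : inner ℂ p ((edgeL2 a b (.up 0) p + z • u) (.up 0)) - inner ℂ p2 (u (.up 0)) =
      inner ℂ p p := by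
    have e1 : (edgeL2 a b (.up 0) p + z • u) (.up 0) = p + z • u (.up 0) :=
      congrArg (· + z • u (.up 0))
        (lp.single_apply_self (E := fun e => Lp ℂ 2 (combMeasure a b e)) 2 (.up 0) p)
    rw [e1, hp2, inner_add_right, inner_smul_right, inner_smul_left, Complex.conj_ofReal, hz]
    ring
  rw [hval] at hup
  have hdown : IsNegSecondDeriv (-(b / 2)) 0 (φ (.down 0)) (φ' (.down 0))
      (fun x => (k ^ 2 : ℝ) * φ (.down 0) x) := by
    refine (h2 (.down 0)).congr ?_
    filter_upwards [Lp.coeFn_add (edgeL2 a b (.up 0) p (.down 0)) (z • u (.down 0)),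
      Lp.coeFn_smul z (u (.down 0)), coeFn_edgeL2_of_ne a b (e := .up 0) (e' := .down 0) p
        (by simp), h1 (.down 0)] with x q1 q2 q3 q4
    change ((edgeL2 a b (.up 0) p (.down 0) + z • u (.down 0) :
      Lp ℂ 2 (combMeasure a b (.down 0))) : ℝ → ℂ) x = _
    rw [q1, Pi.add_apply, q2, q3, Pi.smul_apply, q4, zero_add, smul_eq_mul, hz]
  -- `sin (k (x + b))` continues `sin (k x)` from the upper boundary vertex to the lower one, since
  -- `b / 2` is matched with `-(b / 2)`.
  have hw := hdown.wronskian_sin (neg_nonpos.2 hb2.le) (-b)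
  have hcos2 : Real.cos (k * b) ^ 2 = 1 := by
    have := Real.sin_sq_add_cos_sq (k * b)
    rw [hsb] at this
    linarith
  have hcos2' : (Real.cos (k * b) : ℂ) ^ 2 = 1 := by exact_mod_cast hcos2
  have hpp : inner ℂ p p = 0 := by
    rw [hup]
    simp only [Complex.conj_ofReal, sub_zero, mul_zero, Real.sin_zero, Real.cos_zero, mul_one,
      h3.quasi, h3.quasi_deriv, h3.cont_up, hexp]
    rw [show -(b / 2) - -b = b / 2 by ring, show 0 - -b = b by ring, hsb, h3.cont_down] at hw
    push_cast at hw hcos2' ⊢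
    linear_combination -Complex.cos (k * b) * hw + k * φ (.horiz 0) a * hcos2'
  have hp0 : p = 0 := inner_self_eq_zero.1 hpp
  have hae : (fun x : ℝ => (Real.sin (k * (x - 0)) : ℂ)) =ᵐ[volume.restrict (Icc 0 (b / 2))]
      fun _ => 0 := by
    refine (coeFn_intervalL2 0 (b / 2) _ hsin).symm.trans ?_
    change (p : ℝ → ℂ) =ᵐ[_] _
    rw [hp0]
    exact Lp.coeFn_zero _ _ _
  have heq := Measure.eqOn_Icc_of_ae_eq volume hb2.ne hae hsin.continuousOn continuousOn_const
  have hpi := Real.pi_pos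
  have hx : 0 < min (b / 2) (Real.pi / (2 * k)) := lt_min hb2 (by positivity)
  have h0 := heq (x := min (b / 2) (Real.pi / (2 * k))) ⟨hx.le, min_le_left _ _⟩
  simp only [sub_zero] at h0
  refine (Real.sin_pos_of_pos_of_lt_pi (mul_pos hk hx) ?_).ne' (by exact_mod_cast h0)
  calc k * min (b / 2) (Real.pi / (2 * k)) ≤ k * (Real.pi / (2 * k)) := by
        gcongr; exact min_le_right _ _
    _ = Real.pi / 2 := by field_simp
    _ < Real.pi := by linarith

/-! ### The discrete spectrum of the comb operator -/

/-- The discrete spectrum of the perturbed operator in the gaps of the unperturbed one, in terms of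
a decaying solution with source at the perturbed vertex. -/
theorem exists_sourcedSolution_mem_opDiscreteSpectrum_iff {a b γ θ E : ℝ} (ha : 0 < a)
    (hb : 0 < b) (hE : 0 < E) (γ' : ℝ)
    (hgap : (E : ℂ) ∉ opSpectrum (combOperator a b γ γ θ)) :
    ∃ φ φ', IsSourcedSolution a b γ θ √E 1 φ φ' ∧
      ((E : ℂ) ∈ opDiscreteSpectrum (combOperator a b γ γ' θ) ↔
        (γ' - γ : ℂ) * φ (.horiz 0) a = 1) := by
  obtain ⟨R, hR⟩ := (mem_opResolventSet_iff _ _).1 (not_not.1 hgap)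
  have hT := isRankOnePerturbation_combOperator ha hb γ γ' θ
  have hmem := hR.singularSolution_mem (bumpL2 a b) (bumpNegDeriv2L2 a b)
  rw [combOperator_graph ha hb, ← one_smul ℂ (bumpL2 a b), ← one_smul ℂ (bumpNegDeriv2L2 a b)]
    at hmem
  have hz : (E : ℂ) = ((√E ^ 2 : ℝ) : ℂ) := by rw [Real.sq_sqrt hE.le]
  obtain ⟨φ, φ', hφ, hval⟩ := exists_isSourcedSolution ha hb hz hmem
  refine ⟨φ, φ', hφ, ?_⟩
  have hiff := hT.opEigenspace_ne_bot_iff hR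
  simp only [one_smul] at hval
  rw [hval, ← hiff]
  refine ⟨fun h => h.1, fun h => hT.mem_opDiscreteSpectrum ?_ hgap h⟩
  rw [combOperator_graph ha hb]
  exact combGraph_symmetric ha hb γ γ' θ

/-- The root of smaller modulus of `μ² - 2 f μ + 1`, for `|f| > 1`. -/
theorem exists_small_root {f : ℝ} (hf : 1 < |f|) :
    ∃ μ : ℝ, μ ^ 2 - 2 * f * μ + 1 = 0 ∧ |μ| ≤ 1 ∧
      ∀ g : ℝ, ((f < -1 ∧ g = f + √(f ^ 2 - 1)) ∨ (1 < f ∧ g = f - √(f ^ 2 - 1))) ↔ g = μ := by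
  have hsq : 0 ≤ f ^ 2 - 1 := by
    have := (one_lt_sq_iff_one_lt_abs f).2 hf
    linarith
  have hs := Real.sq_sqrt hsq
  have hs0 := Real.sqrt_nonneg (f ^ 2 - 1)
  rcases lt_abs.1 hf with h | h
  · refine ⟨f - √(f ^ 2 - 1), by linear_combination hs, ?_, fun g => ?_⟩
    · rw [abs_le]
      constructor <;> nlinarith
    · constructor
      · rintro (⟨h', -⟩ | ⟨-, e⟩)
        · linarith
        · exact e
      · exact fun e => Or.inr ⟨h, e⟩
  · refine ⟨f + √(f ^ 2 - 1), by linear_combination hs, ?_, fun g => ?_⟩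
    · rw [abs_le]
      constructor <;> nlinarith
    · constructor
      · rintro (⟨-, e⟩ | ⟨h', -⟩)
        · exact e
        · linarith
      · exact fun e => Or.inl ⟨by linarith, e⟩

theorem combF_sub (a b γ γ' τ k : ℝ) :
    combF a b γ' τ k - combF a b γ τ k = (γ' - γ) * Real.sin (k * a) / (2 * k) := by
  unfold combF
  ring

end

theorem theorem3p2 (a b γ γ' θ E : ℝ) (ha : 0 < a) (hb : 0 < b) (hE : 0 < E)
    (hgap : (E : ℂ) ∉ opSpectrum (combOperator a b γ γ θ)) :
    (√E ∉ XiSet a b →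
      1 < |combF a b γ (Real.cos θ) √E| ∧
      ((E : ℂ) ∈ opDiscreteSpectrum (combOperator a b γ γ' θ) ↔
        ((combF a b γ (Real.cos θ) √E < -1 ∧
            combF a b γ' (Real.cos θ) √E =
              combF a b γ (Real.cos θ) √E + √(combF a b γ (Real.cos θ) √E ^ 2 - 1)) ∨
          (1 < combF a b γ (Real.cos θ) √E ∧
            combF a b γ' (Real.cos θ) √E =
              combF a b γ (Real.cos θ) √E - √(combF a b γ (Real.cos θ) √E ^ 2 - 1))))) ∧
    (√E ∈ XiSet a b → (E : ℂ) ∉ opDiscreteSpectrum (combOperator a b γ γ' θ)) := by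
  obtain ⟨φ, φ', hφ, hiff⟩ :=
    exists_sourcedSolution_mem_opDiscreteSpectrum_iff ha hb hE γ' hgap
  have hk : 0 < √E := Real.sqrt_pos.2 hE
  have hE2 : √E ^ 2 = E := Real.sq_sqrt hE.le
  generalize √E = k at hφ hk hE2 ⊢
  refine ⟨fun hXi => ?_, fun hXi => ?_⟩
  · have hsa : Real.sin (k * a) ≠ 0 := fun h => hXi ⟨hk, Or.inl h⟩
    have hsb : Real.sin (k * b) ≠ 0 := fun h => hXi ⟨hk, Or.inr h⟩
    have hf : 1 < |combF a b γ (Real.cos θ) k| := by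
      by_contra hle
      -- The source of `φ` is `1`, so it cannot vanish.
      exact one_ne_zero (hφ.source_eq_zero_of_abs_le_one ha hb hk hsa hsb (not_lt.1 hle))
    refine ⟨hf, ?_⟩
    obtain ⟨μ, hμ, hμ1, hroot⟩ := exists_small_root hf
    rw [hroot, hiff]
    have hsrc := hφ.source_eq ha hb hk hsa hsb hμ hμ1
    have hdiff := combF_sub a b γ γ' (Real.cos θ) k
    have hr : Real.sin (k * a) / k ≠ 0 := div_ne_zero hsa hk.ne'
    have hr' : ((Real.sin (k * a) / k : ℝ) : ℂ) ≠ 0 := by exact_mod_cast hr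
    have hd2 : 2 * (combF a b γ' (Real.cos θ) k - combF a b γ (Real.cos θ) k) =
        (γ' - γ) * (Real.sin (k * a) / k) := by
      rw [hdiff]
      field_simp
    generalize combF a b γ (Real.cos θ) k = f at *
    generalize combF a b γ' (Real.cos θ) k = f' at *
    generalize Real.sin (k * a) / k = r at *
    -- With `2 (μ - f) φ(x_0) = r` and `2 (f' - f) = (γ' - γ) r`, where `r ≠ 0`, the condition `(γ'
    -- - γ) φ(x_0) = 1` amounts to `f' = μ`.
    constructor
    · intro h
      have h1 : 2 * ((μ - f : ℝ) : ℂ) = (γ' - γ) * r := by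
        linear_combination (-2 * ((μ - f : ℝ) : ℂ)) * h + (γ' - γ : ℂ) * hsrc
      have h2 : 2 * (μ - f) = (γ' - γ) * r := by exact_mod_cast h1
      linarith
    · intro h
      subst h
      have h1 : 2 * ((f' - f : ℝ) : ℂ) = (γ' - γ) * r := by exact_mod_cast hd2
      apply mul_left_cancel₀ hr'
      linear_combination hsrc - φ (.horiz 0) a * h1
  · have hval : φ (.horiz 0) a = 0 := by
      rcases hXi.2 with h | h
      · exact hφ.value_eq_zero_of_sin_eq_zero ha hk h
      · refine hφ.value_eq_zero_of_exp_ne hb hk h fun hexp => hgap ?_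
        exact mem_opSpectrum_of_loop ha hb (by rw [hE2]) hk h hexp
    rw [hiff, hval, mul_zero]
    exact zero_ne_one
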